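/- Work in the category $\mathbf{Loc}$ of locales (the opposite of the category of frames), which has pullbacks and coequalizers. A map of locales $f$ is open if its inverse image $f^*$ has a left adjoint $f_!$ with $f_!(a\wedge f^*(b))=f_!(a)\wedge b$ for all $a,b$, and it is a surjection if $f^*$ is injective. An open groupoid $G$ is an internal groupoid in $\mathbf{Loc}$ with arrows $G_1$, objects $G_0$, domain $d$, range $r$, units $u$, inversion $i$ and multiplication $m:G_1\times_{G_0}G_1\to G_1$ (defined on pairs $(g,g')$ with $r(g)=d(g')$), such that $d$ is open. For open groupoids $G,H$, a $G$-$H$-bilocale is a locale $X$ with a left $G$-action (anchor $p:X\to G_0$ and a unital, associative action $G_1\times_{G_0}X\to X$, $(g,x)\mapsto gx$, defined when $r(g)=p(x)$, with $p(gx)=d(g)$) and a right $H$-action (anchor $q:X\to H_0$ and a unital, associative action $X\times_{H_0}H_1\to X$, $(x,h)\mapsto xh$, defined when $q(x)=d(h)$, with $q(xh)=r(h)$), such that $q(gx)=q(x)$, $p(xh)=p(x)$ and $(gx)h=g(xh)$; all these identities are between maps of locales. Maps of bilocales are the maps of locales commuting with the anchors and actions. A $G$-$H$-bilocale is a principal $G$-$H$-bibundle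 if $q:X\to H_0$ is an open surjection and the pairing map $G_1\times_{G_0}X\to X\times_{H_0}X$, $(g,x)\mapsto(gx,x)$, is an isomorphism of locales. A Hilsum–Skandalis map from $H$ to $G$ is an isomorphism class of principal $G$-$H$-bibundles. For a $G$-$H$-bilocale $X$ and an $H$-$K$-bilocale $X'$, let $X\otimes_H X'$ be the coequalizer in $\mathbf{Loc}$ of the two maps $X\times_{H_0}H_1\times_{H_0}X'\rightrightarrows X\times_{H_0}X'$ given by $(x,h,x')\mapsto(xh,x')$ and $(x,h,x')\mapsto(x,hx')$, with quotient map $(x,x')\mapsto x\otimes x'$. **Lemma.** (1) Let $G,H,K$ be open groupoids, $X$ a principal $G$-$H$-bibundle and $X'$ a principal $H$-$K$-bibundle. Then there is exactly one $G$-$K$-bilocale structure on $X\otimes_H X'$ with $p(x\otimes x')=p(x)$, $q(x\otimes x')=q(x')$, $g(x\otimes x')=(gx)\otimes x'$ and $(x\otimes x')k=x\otimes(x'k)$, and with this structure $X\otimes_H X'$ is a principal $G$-$K$-bibundle. (2) Open groupoids and Hilsum–Skandalis maps form a category: the composite of the Hilsum–Skandalis maps $[X']:K\to H$ and $[X]:H\to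 G$ is $[X\otimes_H X']:K\to G$ (which is well defined on isomorphism classes), this composition is associative, and for every open groupoid $G$ the bilocale $G_1$, on which $G$ acts by multiplication on both sides, is a principal $G$-$G$-bibundle whose class is the identity of $G$. -/

import Mathlib

open CategoryTheory CategoryTheory.Limits

universe u

namespace FrameLimits

variable {A B C : Type u} [Order.Frame A] [Order.Frame B] [Order.Frame C]

lemma lower_mem {D : LowerSet (A × B)} {a a' : A} {b b' : B} (h : (a, b) ∈ D) (ha : a' ≤ a)
    (hb : b' ≤ b) : (a', b') ∈ D :=
  D.lower (Prod.mk_le_mk.2 ⟨ha, hb⟩) h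

/-- The frame of those down-sets `D` of `A × B` that are closed under joins in each variable and
balanced over `C`: it is the pushout of `f : C → A` and `g : C → B` in the category of frames. -/
def pushoutSublocale (f : FrameHom C A) (g : FrameHom C B) : Sublocale (LowerSet (A × B)) where
  carrier := {D | (∀ (s : Set A) (b : B), (∀ a ∈ s, (a, b) ∈ D) → (sSup s, b) ∈ D) ∧
    (∀ (a : A) (t : Set B), (∀ b ∈ t, (a, b) ∈ D) → (a, sSup t) ∈ D) ∧
    (∀ (a : A) (b : B) (c : C), (a ⊓ f c, b) ∈ D ↔ (a, b ⊓ g c) ∈ D)}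
  sInf_mem' S hS := by
    refine ⟨fun s b h => ?_, fun a t h => ?_, fun a b c => ?_⟩
    · simp only [LowerSet.mem_sInf_iff] at h ⊢
      exact fun D hD => (hS hD).1 s b fun a ha => h a ha D hD
    · simp only [LowerSet.mem_sInf_iff] at h ⊢
      exact fun D hD => (hS hD).2.1 a t fun b hb => h b hb D hD
    · simp only [LowerSet.mem_sInf_iff]
      exact forall₂_congr fun D hD => (hS hD).2.2 a b c
  himp_mem' E D hD := by
    have key : ∀ x : A × B, x ∈ E ⇨ D ↔ ∀ y ≤ x, y ∈ E → y ∈ D := by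
      intro x
      rw [← LowerSet.Iic_le, le_himp_iff]
      constructor
      · intro h y hy hE
        exact h ⟨hy, hE⟩
      · rintro h y ⟨hy, hE⟩
        exact h y hy hE
    obtain ⟨h1, h2, h3⟩ := hD
    refine ⟨fun s b h => ?_, fun a t h => ?_, fun a b c => ?_⟩
    · rw [key]
      rintro ⟨a', b'⟩ ⟨ha, hb⟩ hE
      have e : a' = sSup ((fun x => a' ⊓ x) '' s) := by
        rw [sSup_image, ← inf_sSup_eq]; exact (inf_eq_left.2 ha).symm
      rw [e]
      refine h1 _ _ ?_
      rintro _ ⟨x, hx, rfl⟩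
      exact (key _).1 (h x hx) _ ⟨inf_le_right, hb⟩ (lower_mem hE inf_le_left le_rfl)
    · rw [key]
      rintro ⟨a', b'⟩ ⟨ha, hb⟩ hE
      have e : b' = sSup ((fun x => b' ⊓ x) '' t) := by
        rw [sSup_image, ← inf_sSup_eq]; exact (inf_eq_left.2 hb).symm
      rw [e]
      refine h2 _ _ ?_
      rintro _ ⟨x, hx, rfl⟩
      exact (key _).1 (h x hx) _ ⟨ha, inf_le_right⟩ (lower_mem hE le_rfl inf_le_left)
    · rw [key, key]
      constructor
      · rintro h ⟨a', b'⟩ ⟨ha, hb⟩ hE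
        have := h (a' ⊓ f c, b') ⟨inf_le_inf_right _ ha, hb.trans inf_le_left⟩
          (lower_mem hE inf_le_left le_rfl)
        have h4 := (h3 _ _ _).1 this
        rwa [inf_eq_left.2 (hb.trans inf_le_right)] at h4
      · rintro h ⟨a', b'⟩ ⟨ha, hb⟩ hE
        have := h (a', b' ⊓ g c) ⟨ha.trans inf_le_left, inf_le_inf_right _ hb⟩
          (lower_mem hE le_rfl inf_le_left)
        have h4 := (h3 _ _ _).2 this
        rwa [inf_eq_left.2 (ha.trans inf_le_right)] at h4

variable (f : FrameHom C A) (g : FrameHom C B)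

/-- The pure tensor `a ⊗ b`. -/
def tmul (a : A) (b : B) : pushoutSublocale f g :=
  (pushoutSublocale f g).restrict (LowerSet.Iic (a, b))

lemma tmul_le {a : A} {b : B} {D : pushoutSublocale f g} : tmul f g a b ≤ D ↔ (a, b) ∈ D.1 := by
  rw [tmul, (pushoutSublocale f g).giRestrict.gc.le_iff_le, LowerSet.Iic_le]

lemma tmul_inf (a a' : A) (b b' : B) :
    tmul f g (a ⊓ a') (b ⊓ b') = tmul f g a b ⊓ tmul f g a' b' := by
  simp only [tmul, ← map_inf, ← LowerSet.Iic_inf, Prod.mk_inf_mk]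

lemma tmul_top : tmul f g ⊤ ⊤ = ⊤ := by
  rw [tmul, ← map_top (pushoutSublocale f g).restrict]
  congr 1
  exact LowerSet.Iic_top

/-- The first coprojection of the pushout of frames. -/
def inl : FrameHom A (pushoutSublocale f g) where
  toFun a := tmul f g a ⊤
  map_inf' a a' := by rw [← tmul_inf, inf_idem]
  map_top' := tmul_top f g
  map_sSup' s := by
    refine eq_of_forall_ge_iff fun D => ?_
    rw [tmul_le, sSup_le_iff, Set.forall_mem_image]
    simp only [tmul_le]
    exact ⟨fun h a ha => lower_mem h (le_sSup ha) le_rfl, D.2.1 s ⊤⟩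

/-- The second coprojection of the pushout of frames. -/
def inr : FrameHom B (pushoutSublocale f g) where
  toFun b := tmul f g ⊤ b
  map_inf' a a' := by rw [← tmul_inf, inf_idem]
  map_top' := tmul_top f g
  map_sSup' s := by
    refine eq_of_forall_ge_iff fun D => ?_
    rw [tmul_le, sSup_le_iff, Set.forall_mem_image]
    simp only [tmul_le]
    exact ⟨fun h a ha => lower_mem h le_rfl (le_sSup ha), D.2.2.1 ⊤ s⟩

lemma inl_comp : (inl f g).comp f = (inr f g).comp g := by
  ext c : 1
  refine eq_of_forall_ge_iff fun D => ?_
  change tmul f g (f c) ⊤ ≤ D ↔ tmul f g ⊤ (g c) ≤ D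
  rw [tmul_le, tmul_le]
  have := D.2.2.2 ⊤ ⊤ c
  rwa [top_inf_eq, top_inf_eq] at this

lemma inl_inf_inr (a : A) (b : B) : inl f g a ⊓ inr f g b = tmul f g a b := by
  change tmul f g a ⊤ ⊓ tmul f g ⊤ b = _
  rw [← tmul_inf, inf_top_eq, top_inf_eq]

lemma eq_iSup_tmul (D : pushoutSublocale f g) :
    D = ⨆ x ∈ D.1, inl f g x.1 ⊓ inr f g x.2 := by
  refine eq_of_forall_ge_iff fun E => ?_
  simp only [iSup_le_iff, inl_inf_inr, tmul_le]
  rfl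

variable {f g} {Z : Type u} [Order.Frame Z] (h : FrameHom A Z) (k : FrameHom B Z)

/-- The right adjoint of the frame homomorphism induced by a cocone. -/
def descAdj (w : h.comp f = k.comp g) (z : Z) : pushoutSublocale f g :=
  ⟨⟨{x | h x.1 ⊓ k x.2 ≤ z}, fun x y hyx hx =>
    (inf_le_inf (OrderHomClass.mono h hyx.1) (OrderHomClass.mono k hyx.2)).trans hx⟩, by
    have w' : ∀ c, h (f c) = k (g c) := fun c => DFunLike.congr_fun w c
    refine ⟨fun s b hs => ?_, fun a t ht => ?_, fun a b c => ?_⟩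
    · change h (sSup s) ⊓ k b ≤ z
      rw [map_sSup, sSup_inf_eq, iSup₂_le_iff]
      rintro _ ⟨a, ha, rfl⟩
      exact hs a ha
    · change h a ⊓ k (sSup t) ≤ z
      rw [map_sSup, inf_sSup_eq, iSup₂_le_iff]
      rintro _ ⟨b, hb, rfl⟩
      exact ht b hb
    · change h (a ⊓ f c) ⊓ k b ≤ z ↔ h a ⊓ k (b ⊓ g c) ≤ z
      rw [map_inf, map_inf, w', inf_assoc, inf_comm (k b)]⟩

lemma desc_gc (w : h.comp f = k.comp g) : GaloisConnection
    (fun D : pushoutSublocale f g => ⨆ x ∈ D.1, h x.1 ⊓ k x.2) (descAdj h k w) := by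
  intro D z
  rw [iSup₂_le_iff]
  rfl

/-- The frame homomorphism out of a pushout of frames induced by a cocone. -/
def desc (w : h.comp f = k.comp g) : FrameHom (pushoutSublocale f g) Z where
  toFun D := ⨆ x ∈ D.1, h x.1 ⊓ k x.2
  map_inf' D E := by
    apply le_antisymm
    · refine le_inf ?_ ?_ <;> refine iSup₂_le fun x hx => ?_
      · exact le_iSup₂ (f := fun (x : A × B) (_ : x ∈ D.1) => h x.1 ⊓ k x.2) x hx.1
      · exact le_iSup₂ (f := fun (x : A × B) (_ : x ∈ E.1) => h x.1 ⊓ k x.2) x hx.2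
    · simp only [iSup_inf_eq, inf_iSup_eq]
      refine iSup₂_le fun y hy => iSup₂_le fun x hx => ?_
      have hm : x ⊓ y ∈ (D ⊓ E : pushoutSublocale f g).1 := by
        exact ⟨D.1.lower inf_le_left hx, E.1.lower inf_le_right hy⟩
      refine le_trans ?_ (le_iSup₂ (x ⊓ y) hm)
      simp only [Prod.fst_inf, Prod.snd_inf, map_inf]
      exact le_of_eq (by ac_rfl)
  map_top' := by
    refine top_le_iff.1 ?_
    have hm : (⊤ : A × B) ∈ (⊤ : pushoutSublocale f g).1 := trivial
    refine le_trans ?_ (le_iSup₂ (⊤ : A × B) hm)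
    simp
  map_sSup' S := by
    rw [(desc_gc h k w).l_sSup, sSup_image]

lemma desc_tmul (w : h.comp f = k.comp g) (a : A) (b : B) :
    desc h k w (tmul f g a b) = h a ⊓ k b := by
  refine eq_of_forall_ge_iff fun z => ?_
  exact (desc_gc h k w _ _).trans (tmul_le f g)

lemma desc_inl (w : h.comp f = k.comp g) : (desc h k w).comp (inl f g) = h := by
  ext a
  refine (desc_tmul h k w a ⊤).trans ?_
  rw [map_top, inf_top_eq]

lemma desc_inr (w : h.comp f = k.comp g) : (desc h k w).comp (inr f g) = k := by
  ext b
  refine (desc_tmul h k w ⊤ b).trans ?_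
  rw [map_top, top_inf_eq]

lemma hom_ext {m n : FrameHom (pushoutSublocale f g) Z} (hl : m.comp (inl f g) = n.comp (inl f g))
    (hr : m.comp (inr f g) = n.comp (inr f g)) : m = n := by
  have hl' : ∀ a, m (inl f g a) = n (inl f g a) := fun a => DFunLike.congr_fun hl a
  have hr' : ∀ b, m (inr f g b) = n (inr f g b) := fun b => DFunLike.congr_fun hr b
  ext D
  rw [eq_iSup_tmul f g D]
  simp only [map_iSup, map_inf, hl', hr']

/-- The subframe of elements on which two frame homomorphisms agree: their equalizer. -/
abbrev Equ (f g : FrameHom A B) : Type u := {x : A // f x = g x}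

namespace Equ

variable (f g : FrameHom A B)

instance : SupSet (Equ f g) where
  sSup S := ⟨sSup (Subtype.val '' S), by
    simp only [map_sSup]
    congr 1
    rw [Set.image_image, Set.image_image]
    exact Set.image_congr fun x _ => x.2⟩

instance : CompleteLattice (Equ f g) where
  __ := completeLatticeOfSup (Equ f g) fun S =>
    ⟨fun _ hx => le_sSup (α := A) (Set.mem_image_of_mem _ hx), fun _ hy => sSup_le (α := A) (by
      rintro _ ⟨x, hx, rfl⟩
      exact hy hx)⟩
  inf x y := ⟨x.1 ⊓ y.1, by rw [map_inf, map_inf, x.2, y.2]⟩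
  inf_le_left x _ := inf_le_left (a := x.1)
  inf_le_right x _ := inf_le_right (a := x.1)
  le_inf _ _ _ h h' := le_inf (α := A) h h'
  top := ⟨⊤, by rw [map_top, map_top]⟩
  le_top x := le_top (a := x.1)

/-- The inclusion of the equalizer of two frame homomorphisms preserves suprema. -/
lemma coe_sSup (S : Set (Equ f g)) : (sSup S).1 = sSup (Subtype.val '' S) := rfl

instance : Order.Frame (Equ f g) := Order.Frame.ofMinimalAxioms {
  inf_sSup_le_iSup_inf := fun a S => by
    change a.1 ⊓ (sSup S).1 ≤ (⨆ b ∈ S, a ⊓ b : Equ f g).1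
    rw [coe_sSup, inf_sSup_eq]
    refine iSup₂_le ?_
    rintro _ ⟨b, hb, rfl⟩
    exact le_iSup₂ (f := fun (b : Equ f g) (_ : b ∈ S) => a ⊓ b) b hb }

/-- The inclusion of the equalizer of two frame homomorphisms. -/
def incl : FrameHom (Equ f g) A where
  toFun := Subtype.val
  map_inf' _ _ := rfl
  map_top' := rfl
  map_sSup' _ := rfl

lemma comp_incl : f.comp (incl f g) = g.comp (incl f g) :=
  FrameHom.ext fun x => x.2

variable {f g}

/-- The universal property of the equalizer of two frame homomorphisms. -/
def lift (h : FrameHom C A) (w : f.comp h = g.comp h) : FrameHom C (Equ f g) where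
  toFun c := ⟨h c, DFunLike.congr_fun w c⟩
  map_inf' a b := Subtype.ext (map_inf h a b)
  map_top' := Subtype.ext (map_top h)
  map_sSup' S := Subtype.ext (by
    rw [coe_sSup, Set.image_image]
    exact map_sSup h S)

end Equ

instance : HasPushouts Frm.{u} :=
  haveI : ∀ {X Y Z : Frm.{u}} {f : X ⟶ Y} {g : X ⟶ Z}, HasColimit (span f g) := by
    intro X Y Z f g
    have w : ∀ s : PushoutCocone f g, s.inl.hom.comp f.hom = s.inr.hom.comp g.hom :=
      fun s => congrArg Frm.Hom.hom s.condition
    exact ⟨⟨⟨_, PushoutCocone.IsColimit.mk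
      (W := Frm.of (pushoutSublocale f.hom g.hom)) (inl := Frm.ofHom (inl f.hom g.hom))
      (inr := Frm.ofHom (inr f.hom g.hom)) (Frm.hom_ext (inl_comp f.hom g.hom))
      (fun s => Frm.ofHom (desc s.inl.hom s.inr.hom (w s)))
      (fun s => Frm.hom_ext (desc_inl _ _ (w s))) (fun s => Frm.hom_ext (desc_inr _ _ (w s)))
      (fun s m h₁ h₂ => Frm.hom_ext (hom_ext
        ((congrArg Frm.Hom.hom h₁).trans (desc_inl _ _ (w s)).symm)
        ((congrArg Frm.Hom.hom h₂).trans (desc_inr _ _ (w s)).symm)))⟩⟩⟩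
  hasPushouts_of_hasColimit_span _

instance : HasEqualizers Frm.{u} :=
  haveI : ∀ {X Y : Frm.{u}} {f g : X ⟶ Y}, HasLimit (parallelPair f g) :=
    fun {_ _ f g} => ⟨⟨⟨Fork.ofι (P := Frm.of (Equ f.hom g.hom))
      (Frm.ofHom (Equ.incl f.hom g.hom)) (Frm.hom_ext (Equ.comp_incl f.hom g.hom)),
      Fork.IsLimit.mk _ (fun s => Frm.ofHom (Equ.lift s.ι.hom (congrArg Frm.Hom.hom s.condition)))
        (fun _ => rfl) (fun _ _ h => Frm.hom_ext (FrameHom.ext fun x => Subtype.ext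
          (DFunLike.congr_fun (congrArg Frm.Hom.hom h) x)))⟩⟩⟩
  hasEqualizers_of_hasLimit_parallelPair _

end FrameLimits

instance : HasPullbacks Locale.{u} := inferInstanceAs (HasPullbacks Frm.{u}ᵒᵖ)

instance : HasCoequalizers Locale.{u} := inferInstanceAs (HasCoequalizers Frm.{u}ᵒᵖ)

namespace Locale

/-- The inverse image homomorphism `f^*` of a map of locales `f : X ⟶ Y`. -/
def invImage {X Y : Locale.{u}} (f : X ⟶ Y) : FrameHom Y X := Frm.Hom.hom (Quiver.Hom.unop f)

/-- A map of locales is open if its inverse image homomorphism has a left adjoint (the direct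
image) satisfying the Frobenius condition. -/
def IsOpenMap {X Y : Locale.{u}} (f : X ⟶ Y) : Prop :=
  ∃ direct : X → Y, GaloisConnection direct (invImage f) ∧
    ∀ (a : X) (b : Y), direct (a ⊓ invImage f b) = direct a ⊓ b

/-- A map of locales is a surjection if its inverse image homomorphism is injective. -/
def IsSurjection {X Y : Locale.{u}} (f : X ⟶ Y) : Prop := Function.Injective (invImage f)

end Locale

/-- A localic groupoid: an internal groupoid in the category of locales, with domain `d`, range `r`,
units `u`, inversion `i` and multiplication `m`, where `m (g, h)` is defined when `r g = d h`.
The associativity law is stated for generalized elements `f`, `g`, `h` of the locale of arrows. -/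
structure LocalicGroupoid where
  /-- The locale of objects. -/
  G₀ : Locale.{u}
  /-- The locale of arrows. -/
  G₁ : Locale.{u}
  d : G₁ ⟶ G₀
  r : G₁ ⟶ G₀
  u : G₀ ⟶ G₁
  i : G₁ ⟶ G₁
  m : pullback r d ⟶ G₁
  u_d : u ≫ d = 𝟙 G₀
  u_r : u ≫ r = 𝟙 G₀
  i_d : i ≫ d = r
  i_r : i ≫ r = d
  m_d : m ≫ d = pullback.fst r d ≫ d
  m_r : m ≫ r = pullback.snd r d ≫ r
  mul_assoc : ∀ {Z : Locale.{u}} (f g h : Z ⟶ G₁) (w₁ : f ≫ r = g ≫ d) (w₂ : g ≫ r = h ≫ d),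
    pullback.lift (pullback.lift f g w₁ ≫ m) h
      (by rw [Category.assoc, m_r, pullback.lift_snd_assoc, w₂]) ≫ m =
      pullback.lift f (pullback.lift g h w₂ ≫ m)
        (by rw [Category.assoc, m_d, pullback.lift_fst_assoc, w₁]) ≫ m
  one_mul : pullback.lift (d ≫ u) (𝟙 G₁) (by simp [u_r]) ≫ m = 𝟙 G₁
  mul_one : pullback.lift (𝟙 G₁) (r ≫ u) (by simp [u_d]) ≫ m = 𝟙 G₁
  inv_mul : pullback.lift i (𝟙 G₁) (by simp [i_r]) ≫ m = r ≫ u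
  mul_inv : pullback.lift (𝟙 G₁) i (by simp [i_d]) ≫ m = d ≫ u

/-- An open groupoid: a localic groupoid whose domain map is open. -/
structure OpenGroupoid extends LocalicGroupoid.{u} where
  isOpenMap_d : Locale.IsOpenMap d

/-- The structure of a left `G`-locale on `X`: an anchor map `p` and an action `(g, x) ↦ g x`,
defined when `r g = p x`. Associativity is stated for generalized elements. -/
structure LeftAction (G : OpenGroupoid.{u}) (X : Locale.{u}) where
  p : X ⟶ G.G₀
  act : pullback G.r p ⟶ X
  act_p : act ≫ p = pullback.fst G.r p ≫ G.d
  mul_act : ∀ {Z : Locale.{u}} (g g' : Z ⟶ G.G₁) (x : Z ⟶ X) (w₁ : g ≫ G.r = g' ≫ G.d)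
    (w₂ : g' ≫ G.r = x ≫ p),
    pullback.lift (pullback.lift g g' w₁ ≫ G.m) x
      (by rw [Category.assoc, G.m_r, pullback.lift_snd_assoc, w₂]) ≫ act =
      pullback.lift g (pullback.lift g' x w₂ ≫ act)
        (by rw [Category.assoc, act_p, pullback.lift_fst_assoc, w₁]) ≫ act
  one_act : pullback.lift (p ≫ G.u) (𝟙 X) (by simp [G.u_r]) ≫ act = 𝟙 X

/-- The structure of a right `H`-locale on `X`: an anchor map `q` and an action `(x, h) ↦ x h`,
defined when `q x = d h`. Associativity is stated for generalized elements. -/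
structure RightAction (H : OpenGroupoid.{u}) (X : Locale.{u}) where
  q : X ⟶ H.G₀
  ract : pullback q H.d ⟶ X
  ract_q : ract ≫ q = pullback.snd q H.d ≫ H.r
  ract_mul : ∀ {Z : Locale.{u}} (x : Z ⟶ X) (h h' : Z ⟶ H.G₁) (w₁ : x ≫ q = h ≫ H.d)
    (w₂ : h ≫ H.r = h' ≫ H.d),
    pullback.lift (pullback.lift x h w₁ ≫ ract) h'
      (by rw [Category.assoc, ract_q, pullback.lift_snd_assoc, w₂]) ≫ ract =
      pullback.lift x (pullback.lift h h' w₂ ≫ H.m)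
        (by rw [Category.assoc, H.m_d, pullback.lift_fst_assoc, w₁]) ≫ ract
  ract_one : pullback.lift (𝟙 X) (q ≫ H.u) (by simp [H.u_d]) ≫ ract = 𝟙 X

/-- The structure of a `G`-`H`-bilocale on `X`: commuting left and right actions such that each
anchor map is invariant under the other action. -/
structure BilocaleStr (G H : OpenGroupoid.{u}) (X : Locale.{u}) extends
    LeftAction G X, RightAction H X where
  act_q : act ≫ q = pullback.snd G.r p ≫ q
  ract_p : ract ≫ p = pullback.fst q H.d ≫ p
  act_ract : ∀ {Z : Locale.{u}} (g : Z ⟶ G.G₁) (x : Z ⟶ X) (h : Z ⟶ H.G₁)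
    (w₁ : g ≫ G.r = x ≫ p) (w₂ : x ≫ q = h ≫ H.d),
    pullback.lift (pullback.lift g x w₁ ≫ act) h
      (by rw [Category.assoc, act_q, pullback.lift_snd_assoc, w₂]) ≫ ract =
      pullback.lift g (pullback.lift x h w₂ ≫ ract)
        (by rw [Category.assoc, ract_p, pullback.lift_fst_assoc, w₁]) ≫ act

/-- A left `G`-locale `X` with a map `π : X ⟶ M` is a principal `G`-bundle over `M` if `π` is
invariant, the pairing map `⟨act, π₂⟩ : G₁ ×_{G₀} X ⟶ X ×_M X` is an isomorphism and `π` is an open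
surjection. -/
structure LeftAction.IsPrincipalBundle {G : OpenGroupoid.{u}} {X M : Locale.{u}}
    (S : LeftAction G X) (π : X ⟶ M) : Prop where
  invariant : S.act ≫ π = pullback.snd G.r S.p ≫ π
  isIso_pairing : IsIso (pullback.lift S.act (pullback.snd G.r S.p) invariant : _ ⟶ pullback π π)
  isOpenMap : Locale.IsOpenMap π
  isSurjection : Locale.IsSurjection π

namespace BilocaleStr

variable {G H K : OpenGroupoid.{u}} {X X' : Locale.{u}}

/-- A principal `G`-`H`-bibundle: a `G`-`H`-bilocale that is a principal `G`-bundle over `H₀`. -/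
def IsPrincipal (S : BilocaleStr G H X) : Prop := S.toLeftAction.IsPrincipalBundle S.q

/-- The map `(x, h, x') ↦ (x h, x')` from `X ×_{H₀} H₁ ×_{H₀} X'` to `X ×_{H₀} X'`. -/
noncomputable def tensorLeft (S : BilocaleStr G H X) (S' : BilocaleStr H K X') :
    pullback (pullback.snd S.q H.d ≫ H.r) S'.p ⟶ pullback S.q S'.p :=
  pullback.lift (pullback.fst _ _ ≫ S.ract) (pullback.snd _ _)
    (by rw [Category.assoc, S.ract_q, pullback.condition])

/-- The map `(x, h, x') ↦ (x, h x')` from `X ×_{H₀} H₁ ×_{H₀} X'` to `X ×_{H₀} X'`. -/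
noncomputable def tensorRight (S : BilocaleStr G H X) (S' : BilocaleStr H K X') :
    pullback (pullback.snd S.q H.d ≫ H.r) S'.p ⟶ pullback S.q S'.p :=
  pullback.lift (pullback.fst _ _ ≫ pullback.fst _ _)
    (pullback.lift (pullback.fst _ _ ≫ pullback.snd _ _) (pullback.snd _ _)
      (by rw [Category.assoc, pullback.condition]) ≫ S'.act)
    (by rw [Category.assoc, pullback.condition, Category.assoc, S'.act_p,
      pullback.lift_fst_assoc, Category.assoc])

/-- The locale `X ⊗_H X'`: the coequalizer in locales of `(x, h, x') ↦ (x h, x')` and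
`(x, h, x') ↦ (x, h x')`. -/
noncomputable def tensor (S : BilocaleStr G H X) (S' : BilocaleStr H K X') : Locale.{u} :=
  coequalizer (tensorLeft S S') (tensorRight S S')

/-- The quotient map `(x, x') ↦ x ⊗ x'` from `X ×_{H₀} X'` to `X ⊗_H X'`. -/
noncomputable def tensorProj (S : BilocaleStr G H X) (S' : BilocaleStr H K X') :
    pullback S.q S'.p ⟶ tensor S S' :=
  coequalizer.π (tensorLeft S S') (tensorRight S S')

/-- A `G`-`K`-bilocale structure on `X ⊗_H X'` is the one induced by `X` and `X'` if
`p (x ⊗ x') = p x`, `q (x ⊗ x') = q x'`, `g (x ⊗ x') = (g x) ⊗ x'` and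
`(x ⊗ x') k = x ⊗ (x' k)`, for generalized elements. -/
structure IsInduced (S : BilocaleStr G H X) (S' : BilocaleStr H K X')
    (T : BilocaleStr G K (tensor S S')) : Prop where
  proj_p : tensorProj S S' ≫ T.p = pullback.fst _ _ ≫ S.p
  proj_q : tensorProj S S' ≫ T.q = pullback.snd _ _ ≫ S'.q
  act_proj : ∀ {Z : Locale.{u}} (g : Z ⟶ G.G₁) (x : Z ⟶ X) (x' : Z ⟶ X')
    (w₁ : g ≫ G.r = x ≫ S.p) (w₂ : x ≫ S.q = x' ≫ S'.p),
    pullback.lift g (pullback.lift x x' w₂ ≫ tensorProj S S')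
      (by rw [Category.assoc, proj_p, pullback.lift_fst_assoc, w₁]) ≫ T.act =
      pullback.lift (pullback.lift g x w₁ ≫ S.act) x'
        (by rw [Category.assoc, S.act_q, pullback.lift_snd_assoc, w₂]) ≫ tensorProj S S'
  ract_proj : ∀ {Z : Locale.{u}} (x : Z ⟶ X) (x' : Z ⟶ X') (k : Z ⟶ K.G₁)
    (w₁ : x ≫ S.q = x' ≫ S'.p) (w₂ : x' ≫ S'.q = k ≫ K.d),
    pullback.lift (pullback.lift x x' w₁ ≫ tensorProj S S') k
      (by rw [Category.assoc, proj_q, pullback.lift_snd_assoc, w₂]) ≫ T.ract =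
      pullback.lift x (pullback.lift x' k w₂ ≫ S'.ract)
        (by rw [Category.assoc, S'.ract_p, pullback.lift_fst_assoc, w₁]) ≫ tensorProj S S'

/-- The `G`-`G`-bilocale `G₁`, on which `G` acts by multiplication on both sides. -/
def unit (G : OpenGroupoid.{u}) : BilocaleStr G G G.G₁ where
  p := G.d
  act := G.m
  act_p := G.m_d
  mul_act := G.mul_assoc
  one_act := G.one_mul
  q := G.r
  ract := G.m
  ract_q := G.m_r
  ract_mul := G.mul_assoc
  ract_one := G.mul_one
  act_q := G.m_r
  ract_p := G.m_d
  act_ract := G.mul_assoc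

end BilocaleStr

/-- A `G`-`H`-bilocale. -/
structure Bilocale (G H : OpenGroupoid.{u}) where
  X : Locale.{u}
  str : BilocaleStr G H X

namespace Bilocale

variable {G H : OpenGroupoid.{u}}

/-- A map of bilocales: a map of locales that commutes with the anchor maps and with both
actions. -/
@[ext]
structure Hom (A B : Bilocale G H) where
  f : A.X ⟶ B.X
  f_p : f ≫ B.str.p = A.str.p
  f_q : f ≫ B.str.q = A.str.q
  act_f : A.str.act ≫ f = pullback.lift (pullback.fst G.r A.str.p) (pullback.snd G.r A.str.p ≫ f)
    (by rw [Category.assoc, f_p, pullback.condition]) ≫ B.str.act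
  ract_f : A.str.ract ≫ f = pullback.lift (pullback.fst A.str.q H.d ≫ f) (pullback.snd A.str.q H.d)
    (by rw [Category.assoc, f_q, pullback.condition]) ≫ B.str.ract

instance : Category (Bilocale G H) where
  Hom := Hom
  id A :=
    { f := 𝟙 A.X
      f_p := Category.id_comp _
      f_q := Category.id_comp _
      act_f := by
        rw [Category.comp_id, ← Category.id_comp A.str.act]
        congr 1
        ext <;> simp
      ract_f := by
        rw [Category.comp_id, ← Category.id_comp A.str.ract]
        congr 1
        ext <;> simp }
  comp {A B C} φ ψ :=
    { f := φ.f ≫ ψ.f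
      f_p := by rw [Category.assoc, ψ.f_p, φ.f_p]
      f_q := by rw [Category.assoc, ψ.f_q, φ.f_q]
      act_f := by
        rw [← Category.assoc, φ.act_f, Category.assoc, ψ.act_f, ← Category.assoc]
        congr 1
        ext <;> simp [pullback.lift_fst, pullback.lift_snd, pullback.lift_snd_assoc]
      ract_f := by
        rw [← Category.assoc, φ.ract_f, Category.assoc, ψ.ract_f, ← Category.assoc]
        congr 1
        ext <;> simp [pullback.lift_fst, pullback.lift_snd, pullback.lift_fst_assoc] }
  id_comp _ := Hom.ext (Category.id_comp _)
  comp_id _ := Hom.ext (Category.comp_id _)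
  assoc _ _ _ := Hom.ext (Category.assoc _ _ _)

end Bilocale

/-- The category of principal `G`-`H`-bibundles, a full subcategory of the category of
`G`-`H`-bilocales. -/
abbrev PrincipalBibundle (G H : OpenGroupoid.{u}) : Type (u + 1) :=
  ObjectProperty.FullSubcategory fun A : Bilocale G H => A.str.IsPrincipal

/-- A Hilsum--Skandalis map from `H` to `G`: an isomorphism class of principal
`G`-`H`-bibundles. -/
def HSMap (H G : OpenGroupoid.{u}) : Type (u + 1) :=
  _root_.Quotient (isIsomorphicSetoid (PrincipalBibundle G H))

/-- The Hilsum--Skandalis map represented by a principal bibundle. -/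
def HSMap.mk {G H : OpenGroupoid.{u}} {X : Locale.{u}} (S : BilocaleStr G H X)
    (hS : S.IsPrincipal) : HSMap H G :=
  _root_.Quotient.mk (isIsomorphicSetoid (PrincipalBibundle G H)) ⟨⟨X, S⟩, hS⟩

/-!
Open surjections of locales are stable under pullback (Beck–Chevalley) and are the coequalizers of
their kernel pairs. Hence a map out of the target of an open surjection may be defined, and an
equation between such maps checked, on generalized elements of its source.

Let `X` be a `G`-`H`-bilocale and let `X'` be a principal `H`-`K`-bibundle. Principality provides,
for `e` and `x'` in the same fibre of `q : X' ⟶ K₀`, a unique `h` with `h e = x'`, and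
`e • (x, x') = (x h, e)` is a descent datum along `q` on the projection `X ×_{H₀} X' ⟶ X'`. Its
quotient is `X ⊗_H X'`. By descent, `(x, x') ↦ x ⊗ x'` is an open surjection and exhibits
`X ×_{H₀} X'` as the pullback of `X'` and `X ⊗_H X'` over `K₀`. Therefore `x ⊗ x' = y ⊗ y'` if and
only if `x = y h` and `h x' = y'` for some `h`, and both the bilocale structure and its principality
can be verified on pairs `(x, x')`.

A map between principal bibundles is an isomorphism, so the unit and associativity laws only
require maps of bilocales, and these are defined on pairs and triples by `x ⊗ h ↦ x h`,
`g ⊗ x ↦ g x` and `x ⊗ (x' ⊗ x'') ↦ (x ⊗ x') ⊗ x''`.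
-/

open Locale (invImage IsSurjection)

attribute [local simp] pullback.lift_fst pullback.lift_snd pullback.lift_fst_assoc
  pullback.lift_snd_assoc

section PullbackMap

variable {C : Type*} [Category C] [HasPullbacks C] {X Y Z W : C}

lemma comp_pullback_lift {V : C} {f : X ⟶ Z} {g : Y ⟶ Z} (k : V ⟶ W) (x : W ⟶ X) (y : W ⟶ Y)
    (w : x ≫ f = y ≫ g) :
    k ≫ pullback.lift x y w = pullback.lift (k ≫ x) (k ≫ y) (by simp [w]) := by
  apply pullback.hom_ext <;> simp

lemma comp_pullback_lift_assoc {U V : C} {f : X ⟶ Z} {g : Y ⟶ Z} (k : V ⟶ W) (x : W ⟶ X)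
    (y : W ⟶ Y) (w : x ≫ f = y ≫ g) (c : pullback f g ⟶ U) :
    k ≫ pullback.lift x y w ≫ c = pullback.lift (k ≫ x) (k ≫ y) (by simp [w]) ≫ c := by
  rw [← Category.assoc, comp_pullback_lift]

/-- The map `(x, y) ↦ (x, e y)` between pullbacks. -/
noncomputable def pullbackMapSnd (f : X ⟶ Z) {g : Y ⟶ Z} {g' : W ⟶ Z} (e : W ⟶ Y)
    (h : e ≫ g = g') : pullback f g' ⟶ pullback f g :=
  pullback.lift (pullback.fst f g') (pullback.snd f g' ≫ e)
    (by rw [Category.assoc, h, pullback.condition])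

/-- The map `(x, y) ↦ (e x, y)` between pullbacks. -/
noncomputable def pullbackMapFst {f : X ⟶ Z} {f' : W ⟶ Z} (g : Y ⟶ Z) (e : W ⟶ X)
    (h : e ≫ f = f') : pullback f' g ⟶ pullback f g :=
  pullback.lift (pullback.fst f' g ≫ e) (pullback.snd f' g)
    (by rw [Category.assoc, h, pullback.condition])

section

variable (f : X ⟶ Z) {g : Y ⟶ Z} {g' : W ⟶ Z} (e : W ⟶ Y) (h : e ≫ g = g')

@[simp]
lemma pullbackMapSnd_fst : pullbackMapSnd f e h ≫ pullback.fst f g = pullback.fst f g' :=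
  pullback.lift_fst _ _ _

@[simp]
lemma pullbackMapSnd_snd : pullbackMapSnd f e h ≫ pullback.snd f g = pullback.snd f g' ≫ e :=
  pullback.lift_snd _ _ _

lemma isPullback_pullbackMapSnd :
    IsPullback (pullbackMapSnd f e h) (pullback.snd f g') (pullback.snd f g) e := by
  subst h
  refine .of_right ?_ (pullbackMapSnd_snd f e rfl) (.of_hasPullback f g)
  rw [pullbackMapSnd_fst]
  exact .of_hasPullback f (e ≫ g)

end

section

variable {f : X ⟶ Z} {f' : W ⟶ Z} (g : Y ⟶ Z) (e : W ⟶ X) (h : e ≫ f = f')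

@[simp]
lemma pullbackMapFst_fst : pullbackMapFst g e h ≫ pullback.fst f g = pullback.fst f' g ≫ e :=
  pullback.lift_fst _ _ _

@[simp]
lemma pullbackMapFst_snd : pullbackMapFst g e h ≫ pullback.snd f g = pullback.snd f' g :=
  pullback.lift_snd _ _ _

lemma isPullback_pullbackMapFst :
    IsPullback (pullbackMapFst g e h) (pullback.fst f' g) (pullback.fst f g) e := by
  subst h
  refine .of_right ?_ (pullbackMapFst_fst g e rfl) (IsPullback.of_hasPullback f g).flip
  rw [pullbackMapFst_snd]
  exact (IsPullback.of_hasPullback (e ≫ f) g).flip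

end

end PullbackMap

namespace FrameLimits

variable {A B C : Type u} [Order.Frame A] [Order.Frame B] [Order.Frame C]
  {f : FrameHom C A} {l : A → C}

/-- The element of the pushout of `f` and `g` formed by the rectangles `(a, b)` with
`g (l a) ⊓ b ≤ z`, where `l` is a direct image for `f`: by `restrictLE_eq_inr` an explicit
description of `inr f g z`. -/
def restrictLE (g : FrameHom C B) (hl : GaloisConnection l f)
    (hF : ∀ a c, l (a ⊓ f c) = l a ⊓ c) (z : B) : pushoutSublocale f g :=
  ⟨⟨{x | g (l x.1) ⊓ x.2 ≤ z}, fun x y hyx hx =>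
    (inf_le_inf (OrderHomClass.mono g (hl.monotone_l hyx.1)) hyx.2).trans hx⟩, by
    refine ⟨fun s b hs => ?_, fun a t ht => ?_, fun a b c => ?_⟩
    · change g (l (sSup s)) ⊓ b ≤ z
      rw [hl.l_sSup, map_iSup₂, iSup₂_inf_eq]
      exact iSup₂_le hs
    · change g (l a) ⊓ sSup t ≤ z
      rw [inf_sSup_eq]
      exact iSup₂_le ht
    · change g (l (a ⊓ f c)) ⊓ b ≤ z ↔ g (l a) ⊓ (b ⊓ g c) ≤ z
      rw [hF, map_inf, inf_assoc, inf_comm b]⟩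

lemma restrictLE_eq_inr (g : FrameHom C B) (hl : GaloisConnection l f)
    (hF : ∀ a c, l (a ⊓ f c) = l a ⊓ c) (z : B) : restrictLE g hl hF z = inr f g z := by
  apply le_antisymm
  · rintro ⟨a, b⟩ (h : g (l a) ⊓ b ≤ z)
    have top_mem : (⊤, z) ∈ (inr f g z).1 := (tmul_le f g).1 le_rfl
    have mem : (a ⊓ f (l a), b) ∈ (inr f g z).1 :=
      ((inr f g z).2.2.2 a b (l a)).2 (lower_mem top_mem le_top (by rwa [inf_comm]))
    rwa [inf_eq_left.2 (hl.le_u_l a)] at mem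
  · exact (tmul_le f g).2 inf_le_right

/-- The direct image along the coprojection `inr f g`, where `l` is a direct image for `f`. -/
def direct (g : FrameHom C B) (l : A → C) (D : pushoutSublocale f g) : B :=
  ⨆ x ∈ D.1, g (l x.1) ⊓ x.2

lemma direct_gc (g : FrameHom C B) (hl : GaloisConnection l f)
    (hF : ∀ a c, l (a ⊓ f c) = l a ⊓ c) :
    GaloisConnection (direct g l : pushoutSublocale f g → B) (inr f g) := by
  intro D z
  rw [← restrictLE_eq_inr g hl hF, direct, iSup₂_le_iff]
  rfl

lemma direct_inl (g : FrameHom C B) (hl : GaloisConnection l f)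
    (hF : ∀ a c, l (a ⊓ f c) = l a ⊓ c) (a : A) : direct g l (inl f g a) = g (l a) := by
  refine eq_of_forall_ge_iff fun z => ?_
  rw [direct_gc g hl hF, ← restrictLE_eq_inr g hl hF, ← inf_top_eq (g (l a))]
  exact tmul_le f g

lemma direct_inf_inr (g : FrameHom C B) (hl : GaloisConnection l f)
    (hF : ∀ a c, l (a ⊓ f c) = l a ⊓ c) (D : pushoutSublocale f g) (b : B) :
    direct g l (D ⊓ inr f g b) = direct g l D ⊓ b := by
  have gc := direct_gc g hl hF
  apply le_antisymm
  · exact le_inf (gc.monotone_l inf_le_left) (gc.l_le inf_le_right)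
  · rw [direct, iSup₂_inf_eq]
    refine iSup₂_le fun x hx => ?_
    rw [inf_assoc]
    refine le_iSup₂ (f := fun (x : A × B) (_ : x ∈ (D ⊓ inr f g b).1) => g (l x.1) ⊓ x.2)
      (x.1, x.2 ⊓ b) ⟨lower_mem hx le_rfl inf_le_left, ?_⟩
    exact lower_mem ((tmul_le f g).1 le_rfl) le_top inf_le_right

end FrameLimits

namespace LocaleMap

variable {X Y Z W P : Locale.{u}}

lemma invImage_id (x : X) : invImage (𝟙 X) x = x := rfl

lemma invImage_comp (f : X ⟶ Y) (g : Y ⟶ Z) (z : Z) :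
    invImage (f ≫ g) z = invImage f (invImage g z) := rfl

lemma invImage_congr {f g : X ⟶ Y} (h : f = g) (y : Y) : invImage f y = invImage g y := by rw [h]

lemma hom_ext {f g : X ⟶ Y} (h : ∀ y, invImage f y = invImage g y) : f = g :=
  Quiver.Hom.unop_inj (Frm.hom_ext (FrameHom.ext h))

/-- The map of locales with a given inverse image homomorphism. -/
def ofFrameHom (φ : FrameHom Y X) : X ⟶ Y :=
  Quiver.Hom.op (X := Y.unop) (Y := X.unop) (Frm.ofHom φ)

/-! ### Pullbacks and open maps -/

/-- The locale of the pushout of the inverse image homomorphisms of `f` and `g`: an explicit model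
of the pullback of `f` and `g`. -/
def pullbackModel (f : X ⟶ Z) (g : Y ⟶ Z) : Locale.{u} :=
  Locale.of (FrameLimits.pushoutSublocale (invImage f) (invImage g))

/-- The first projection of `pullbackModel f g`. -/
def modelFst (f : X ⟶ Z) (g : Y ⟶ Z) : pullbackModel f g ⟶ X :=
  ofFrameHom (X := pullbackModel f g) (FrameLimits.inl (invImage f) (invImage g))

/-- The second projection of `pullbackModel f g`. -/
def modelSnd (f : X ⟶ Z) (g : Y ⟶ Z) : pullbackModel f g ⟶ Y :=
  ofFrameHom (X := pullbackModel f g) (FrameLimits.inr (invImage f) (invImage g))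

lemma isPullback_pullbackModel (f : X ⟶ Z) (g : Y ⟶ Z) :
    IsPullback (modelFst f g) (modelSnd f g) f g := by
  refine IsPullback.mk' (hom_ext fun c => DFunLike.congr_fun (FrameLimits.inl_comp _ _) c)
    (fun T a b hfst hsnd => ?_) fun T a b w => ?_
  · refine hom_ext fun D => DFunLike.congr_fun (FrameLimits.hom_ext (m := invImage a)
      (n := invImage b) ?_ ?_) D
    · exact FrameHom.ext (invImage_congr hfst)
    · exact FrameHom.ext (invImage_congr hsnd)
  · have w' : (invImage a).comp (invImage f) = (invImage b).comp (invImage g) :=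
      FrameHom.ext (invImage_congr w)
    exact ⟨ofFrameHom (Y := pullbackModel f g) (FrameLimits.desc (invImage a) (invImage b) w'),
      hom_ext fun x => DFunLike.congr_fun (FrameLimits.desc_inl _ _ w') x,
      hom_ext fun y => DFunLike.congr_fun (FrameLimits.desc_inr _ _ w') y⟩

lemma exists_eq_iSup_of_isPullback {fst : P ⟶ X} {snd : P ⟶ Y} {f : X ⟶ Z} {g : Y ⟶ Z}
    (h : IsPullback fst snd f g) (w : P) :
    ∃ D : Set (X × Y), w = ⨆ x ∈ D, invImage fst x.1 ⊓ invImage snd x.2 := by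
  let e := h.isoIsPullback X Y (isPullback_pullbackModel f g)
  have hfst : e.hom ≫ modelFst f g = fst := h.isoIsPullback_hom_fst _ _ _
  have hsnd : e.hom ≫ modelSnd f g = snd := h.isoIsPullback_hom_snd _ _ _
  let D : FrameLimits.pushoutSublocale (invImage f) (invImage g) := invImage e.inv w
  have hD : D = ⨆ x ∈ D.1, invImage (modelFst f g) x.1 ⊓ invImage (modelSnd f g) x.2 :=
    FrameLimits.eq_iSup_tmul _ _ D
  refine ⟨D.1, ?_⟩
  calc w = invImage e.hom D := (invImage_congr e.hom_inv_id w).symm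
    _ = ⨆ x ∈ D.1, invImage (e.hom ≫ modelFst f g) x.1 ⊓ invImage (e.hom ≫ modelSnd f g) x.2 := by
      conv_lhs => rw [hD]
      simp only [map_iSup, map_inf, invImage_comp]
    _ = _ := by
      rw [hfst, hsnd]
      rfl

/-- The direct image `f_!` along an open map of locales. -/
noncomputable def directImage {f : X ⟶ Y} (hf : Locale.IsOpenMap f) : X → Y := hf.choose

lemma directImage_gc {f : X ⟶ Y} (hf : Locale.IsOpenMap f) :
    GaloisConnection (directImage hf) (invImage f) :=
  hf.choose_spec.1

lemma directImage_inf {f : X ⟶ Y} (hf : Locale.IsOpenMap f) (a : X) (b : Y) :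
    directImage hf (a ⊓ invImage f b) = directImage hf a ⊓ b :=
  hf.choose_spec.2 a b

lemma isOpenMap_comp {f : X ⟶ Y} {g : Y ⟶ Z} (hf : Locale.IsOpenMap f)
    (hg : Locale.IsOpenMap g) : Locale.IsOpenMap (f ≫ g) := by
  refine ⟨directImage hg ∘ directImage hf, (directImage_gc hf).compose (directImage_gc hg),
    fun a b => ?_⟩
  simp only [Function.comp_apply, invImage_comp, directImage_inf]

lemma invImage_inv_gc (e : X ≅ Y) : GaloisConnection (invImage e.inv) (invImage e.hom) := by
  have hom_inv (x : X) : invImage e.hom (invImage e.inv x) = x := invImage_congr e.hom_inv_id x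
  have inv_hom (y : Y) : invImage e.inv (invImage e.hom y) = y := invImage_congr e.inv_hom_id y
  refine fun x y => ⟨fun h => ?_, fun h => ?_⟩
  · simpa only [hom_inv] using OrderHomClass.mono (invImage e.hom) h
  · simpa only [inv_hom] using OrderHomClass.mono (invImage e.inv) h

lemma isOpenMap_of_isIso (f : X ⟶ Y) [IsIso f] : Locale.IsOpenMap f :=
  ⟨invImage (inv f), invImage_inv_gc (asIso f), fun x y => by
    rw [map_inf, ← invImage_comp, IsIso.inv_hom_id, invImage_id]⟩

lemma isOpenMap_modelSnd {f : X ⟶ Z} (hf : Locale.IsOpenMap f) (g : Y ⟶ Z) :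
    Locale.IsOpenMap (modelSnd f g) :=
  ⟨FrameLimits.direct (invImage g) (directImage hf),
    FrameLimits.direct_gc _ (directImage_gc hf) (directImage_inf hf),
    FrameLimits.direct_inf_inr _ (directImage_gc hf) (directImage_inf hf)⟩

section IsPullback

variable {fst : P ⟶ X} {snd : P ⟶ Y} {f : X ⟶ Z} {g : Y ⟶ Z}

lemma isOpenMap_of_isPullback (h : IsPullback fst snd f g) (hf : Locale.IsOpenMap f) :
    Locale.IsOpenMap snd := by
  rw [← h.isoIsPullback_hom_snd X Y (isPullback_pullbackModel f g)]
  exact isOpenMap_comp (isOpenMap_of_isIso _) (isOpenMap_modelSnd hf g)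

/-- The Beck–Chevalley condition. -/
lemma directImage_invImage_of_isPullback (h : IsPullback fst snd f g) (hf : Locale.IsOpenMap f)
    (hs : Locale.IsOpenMap snd) (a : X) :
    directImage hs (invImage fst a) = invImage g (directImage hf a) := by
  let e := h.isoIsPullback X Y (isPullback_pullbackModel f g)
  have hfst : e.inv ≫ fst = modelFst f g := h.isoIsPullback_inv_fst _ _ _
  have hsnd : e.hom ≫ modelSnd f g = snd := h.isoIsPullback_hom_snd _ _ _
  have gc : GaloisConnection
      (FrameLimits.direct (invImage g) (directImage hf) ∘ invImage e.inv) (invImage snd) := by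
    intro w b
    rw [← hsnd]
    exact (FrameLimits.direct_gc (invImage g) (directImage_gc hf) (directImage_inf hf) _ _).trans
      (invImage_inv_gc e w _)
  rw [(directImage_gc hs).l_unique gc fun _ => rfl]
  exact (congrArg _ (invImage_congr hfst a)).trans
    (FrameLimits.direct_inl _ (directImage_gc hf) (directImage_inf hf) a)

end IsPullback

/-! ### Surjections -/

lemma le_iff_of_isSurjection {f : X ⟶ Y} (hf : IsSurjection f) {a b : Y} :
    invImage f a ≤ invImage f b ↔ a ≤ b := by
  rw [← inf_eq_left, ← map_inf, hf.eq_iff, inf_eq_left]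

lemma epi_of_isSurjection {f : X ⟶ Y} (hf : IsSurjection f) : Epi f where
  left_cancellation _ _ h := hom_ext fun z => hf (invImage_congr h z)

lemma isSurjection_of_section {f : X ⟶ Y} {s : Y ⟶ X} (h : s ≫ f = 𝟙 Y) : IsSurjection f :=
  Function.LeftInverse.injective (g := invImage s) (invImage_congr h)

lemma isSurjection_of_comp {f : X ⟶ Y} {g : Y ⟶ Z} (h : IsSurjection (f ≫ g)) :
    IsSurjection g :=
  Function.Injective.of_comp (f := invImage f) h

lemma exists_comp_eq_of_isSurjection {e : X ⟶ Y} (he : IsSurjection e) (c : X ⟶ Z)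
    (h : ∀ z, invImage c z ∈ Set.range (invImage e)) : ∃ j : Y ⟶ Z, e ≫ j = c := by
  choose k hk using h
  refine ⟨ofFrameHom
    { toFun := k
      map_inf' := fun a b => he (by rw [hk, map_inf, map_inf, hk, hk])
      map_top' := he (by rw [hk, map_top, map_top])
      map_sSup' := fun S => he (by
        rw [hk, map_sSup, map_sSup, Set.image_image]
        simp only [hk]) }, hom_ext hk⟩

lemma isSurjection_and_range_of_isColimit {f g : X ⟶ Y} {τ : Y ⟶ Z} {w : f ≫ τ = g ≫ τ}
    (hτ : IsColimit (Cofork.ofπ τ w)) :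
    IsSurjection τ ∧ ∀ y, invImage f y = invImage g y → y ∈ Set.range (invImage τ) := by
  let Q : Locale.{u} := Locale.of (FrameLimits.Equ (invImage f) (invImage g))
  let ι : Y ⟶ Q := ofFrameHom (X := Y) (Y := Q) (FrameLimits.Equ.incl (invImage f) (invImage g))
  have hι : f ≫ ι = g ≫ ι := hom_ext Subtype.property
  let j : Q ⟶ Z := ofFrameHom (X := Q) (FrameLimits.Equ.lift (invImage τ)
    (FrameHom.ext (invImage_congr w)))
  have hj : ι ≫ j = τ := hom_ext fun _ => rfl
  obtain ⟨(k : Z ⟶ Q), (hk : τ ≫ k = ι)⟩ := Cofork.IsColimit.desc' hτ ι hι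
  have hkj : k ≫ j = 𝟙 Z := Cofork.IsColimit.hom_ext hτ (by
    change τ ≫ k ≫ j = τ ≫ 𝟙 Z
    rw [reassoc_of% hk, hj, Category.comp_id])
  refine ⟨?_, fun y hy => ⟨invImage k ⟨y, hy⟩, invImage_congr hk _⟩⟩
  rw [← hj]
  exact Function.Injective.comp (g := invImage ι) Subtype.val_injective
    (isSurjection_of_section hkj)

end LocaleMap

open LocaleMap

/-- An open surjection of locales. -/
structure IsOpenSurjection {X Y : Locale.{u}} (f : X ⟶ Y) : Prop where
  isOpenMap : Locale.IsOpenMap f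
  isSurjection : IsSurjection f

namespace IsOpenSurjection

variable {X Y Z W P : Locale.{u}}

lemma directImage_invImage {f : X ⟶ Y} (hf : IsOpenSurjection f) (b : Y) :
    directImage hf.isOpenMap (invImage f b) = b := by
  refine le_antisymm ((directImage_gc _).l_u_le b) ((le_iff_of_isSurjection hf.isSurjection).1 ?_)
  exact (directImage_gc hf.isOpenMap).le_u_l _

lemma epi {f : X ⟶ Y} (hf : IsOpenSurjection f) : Epi f := epi_of_isSurjection hf.isSurjection

lemma comp {f : X ⟶ Y} {g : Y ⟶ Z} (hf : IsOpenSurjection f) (hg : IsOpenSurjection g) :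
    IsOpenSurjection (f ≫ g) :=
  ⟨isOpenMap_comp hf.1 hg.1, hf.2.comp hg.2⟩

lemma of_isIso (f : X ⟶ Y) [IsIso f] : IsOpenSurjection f :=
  ⟨isOpenMap_of_isIso f, isSurjection_of_section (IsIso.inv_hom_id f)⟩

lemma of_isPullback {fst : P ⟶ X} {snd : P ⟶ Y} {f : X ⟶ Z} {g : Y ⟶ Z}
    (h : IsPullback fst snd f g) (hf : IsOpenSurjection f) : IsOpenSurjection snd := by
  have hs := isOpenMap_of_isPullback h hf.isOpenMap
  refine ⟨hs, Function.LeftInverse.injective (g := directImage hs) fun b => ?_⟩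
  rw [← top_inf_eq (invImage snd b), directImage_inf, ← map_top (invImage fst),
    directImage_invImage_of_isPullback h hf.isOpenMap, ← map_top (invImage f),
    hf.directImage_invImage, map_top, top_inf_eq]

lemma pullback_snd {f : X ⟶ Z} (hf : IsOpenSurjection f) (g : Y ⟶ Z) :
    IsOpenSurjection (pullback.snd f g) :=
  hf.of_isPullback (.of_hasPullback f g)

lemma pullback_fst (f : X ⟶ Z) {g : Y ⟶ Z} (hg : IsOpenSurjection g) :
    IsOpenSurjection (pullback.fst f g) :=
  hg.of_isPullback (IsPullback.of_hasPullback f g).flip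

lemma of_comp {e : X ⟶ Y} {p : Y ⟶ Z} (h : IsOpenSurjection (e ≫ p)) (he : IsSurjection e) :
    IsOpenSurjection p := by
  refine ⟨⟨directImage h.isOpenMap ∘ invImage e, fun y z => ?_, fun y z => ?_⟩,
    isSurjection_of_comp h.isSurjection⟩
  · rw [Function.comp_apply, directImage_gc h.isOpenMap, invImage_comp, le_iff_of_isSurjection he]
  · rw [Function.comp_apply, map_inf, ← invImage_comp, directImage_inf, Function.comp_apply]

lemma pullbackMapSnd (f : X ⟶ Z) {g : Y ⟶ Z} {g' : W ⟶ Z} {e : W ⟶ Y}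
    (he : IsOpenSurjection e) (h : e ≫ g = g') : IsOpenSurjection (pullbackMapSnd f e h) :=
  he.of_isPullback (isPullback_pullbackMapSnd f e h).flip

lemma pullbackMapFst {f : X ⟶ Z} {f' : W ⟶ Z} (g : Y ⟶ Z) {e : W ⟶ X}
    (he : IsOpenSurjection e) (h : e ≫ f = f') : IsOpenSurjection (pullbackMapFst g e h) :=
  he.of_isPullback (isPullback_pullbackMapFst g e h).flip

lemma exists_desc {e : X ⟶ Y} (he : IsOpenSurjection e) (c : X ⟶ Z)
    (h : ∀ {W : Locale.{u}} (a b : W ⟶ X), a ≫ e = b ≫ e → a ≫ c = b ≫ c) :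
    ∃ j : Y ⟶ Z, e ≫ j = c := by
  refine exists_comp_eq_of_isSurjection he.isSurjection c fun z =>
    ⟨directImage he.isOpenMap (invImage c z), ?_⟩
  have hs := he.pullback_snd e
  rw [← directImage_invImage_of_isPullback (.of_hasPullback e e) he.isOpenMap hs.isOpenMap,
    ← invImage_comp, h _ _ pullback.condition, invImage_comp, hs.directImage_invImage]

lemma isIso_of_mono {f : X ⟶ Y} [Mono f] {ζ : Z ⟶ Y} (hζ : IsOpenSurjection ζ) (s : Z ⟶ X)
    (h : s ≫ f = ζ) : IsIso f := by
  obtain ⟨k, hk⟩ := hζ.exists_desc s fun a b hab => by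
    rw [← cancel_mono f, Category.assoc, Category.assoc, h, hab]
  have := hζ.epi
  have hkf : k ≫ f = 𝟙 Y := by rw [← cancel_epi ζ, reassoc_of% hk, h, Category.comp_id]
  exact ⟨k, by rw [← cancel_mono f, Category.assoc, hkf, Category.comp_id, Category.id_comp], hkf⟩

end IsOpenSurjection

/-! ### Descent along open surjections -/

/-- A descent datum on `φ : Y ⟶ E` along `π : E ⟶ B`: an action `(e, y) ↦ e • y` of the kernel pair
of `π` on `Y`, defined when `π e = π (φ y)`, with `φ (e • y) = e`. Associativity is stated for
generalized elements. -/
structure DescentDatum {E B Y : Locale.{u}} (π : E ⟶ B) (φ : Y ⟶ E) where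
  act : pullback π (φ ≫ π) ⟶ Y
  act_comp : act ≫ φ = pullback.fst π (φ ≫ π)
  self_act : pullback.lift φ (𝟙 Y) (by simp) ≫ act = 𝟙 Y
  act_act : ∀ {Z : Locale.{u}} (e e' : Z ⟶ E) (y : Z ⟶ Y) (w : e ≫ π = e' ≫ π)
    (w' : e' ≫ π = y ≫ φ ≫ π),
    pullback.lift e (pullback.lift e' y w' ≫ act)
      (by rw [Category.assoc, reassoc_of% act_comp, pullback.lift_fst_assoc, w]) ≫ act =
      pullback.lift e y (w.trans w') ≫ act

namespace DescentDatum

variable {E B Y Q : Locale.{u}} {π : E ⟶ B} {φ : Y ⟶ E} (D : DescentDatum π φ)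

lemma act_comp_comp : D.act ≫ φ ≫ π = pullback.snd π (φ ≫ π) ≫ φ ≫ π := by
  rw [reassoc_of% D.act_comp, pullback.condition]

/-- The map `(e, e', y) ↦ (e, e' • y)`. -/
noncomputable def actSnd :
    pullback π (pullback.snd π (φ ≫ π) ≫ φ ≫ π) ⟶ pullback π (φ ≫ π) :=
  pullbackMapSnd π D.act D.act_comp_comp

variable (π φ) in
/-- The map `(e, e', y) ↦ (e, y)`. -/
noncomputable def forgetMiddle :
    pullback π (pullback.snd π (φ ≫ π) ≫ φ ≫ π) ⟶ pullback π (φ ≫ π) :=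
  pullbackMapSnd π (pullback.snd π (φ ≫ π)) rfl

lemma actSnd_act : D.actSnd ≫ D.act = forgetMiddle π φ ≫ D.act := by
  have h := D.act_act (pullback.fst π (pullback.snd π (φ ≫ π) ≫ φ ≫ π))
    (pullback.snd _ _ ≫ pullback.fst π (φ ≫ π)) (pullback.snd _ _ ≫ pullback.snd π (φ ≫ π))
    (by rw [pullback.condition, Category.assoc, pullback.condition])
    (by rw [Category.assoc, Category.assoc, pullback.condition])
  have lift_snd_act : pullback.lift (pullback.snd _ _ ≫ pullback.fst π (φ ≫ π))
      (pullback.snd _ _ ≫ pullback.snd π (φ ≫ π))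
      (by rw [Category.assoc, Category.assoc, pullback.condition]) ≫ D.act =
      pullback.snd π (pullback.snd π (φ ≫ π) ≫ φ ≫ π) ≫ D.act := by
    congr 1
    apply pullback.hom_ext <;> simp
  simp only [lift_snd_act] at h
  exact h

lemma invImage_act_directImage (hπ : IsOpenSurjection π) (y : Y) :
    invImage D.act (directImage (hπ.pullback_snd (φ ≫ π)).isOpenMap (invImage D.act y)) =
      invImage (pullback.snd π (φ ≫ π))
        (directImage (hπ.pullback_snd (φ ≫ π)).isOpenMap (invImage D.act y)) := by
  have hn := (hπ.pullback_snd (pullback.snd π (φ ≫ π) ≫ φ ≫ π)).isOpenMap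
  rw [← directImage_invImage_of_isPullback (isPullback_pullbackMapSnd π D.act D.act_comp_comp) _ hn,
    ← directImage_invImage_of_isPullback (isPullback_pullbackMapSnd π _ rfl) _ hn]
  exact congrArg _ (invImage_congr D.actSnd_act y)

section Quotient

variable {D} {τ : Y ⟶ Q} {w : D.act ≫ τ = pullback.snd π (φ ≫ π) ≫ τ}

lemma exists_directImage (hπ : IsOpenSurjection π) (hτ : IsColimit (Cofork.ofπ τ w)) :
    ∃ l : Y → Q, GaloisConnection l (invImage τ) ∧ ∀ y, invImage τ (l y) =
      directImage (hπ.pullback_snd (φ ≫ π)).isOpenMap (invImage D.act y) := by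
  obtain ⟨hτ_surj, hτ_range⟩ := isSurjection_and_range_of_isColimit hτ
  choose l hl using fun y => hτ_range _ (D.invImage_act_directImage hπ y)
  refine ⟨l, fun y q => ?_, hl⟩
  rw [← le_iff_of_isSurjection hτ_surj, hl, directImage_gc, ← invImage_comp, ← w, invImage_comp,
    le_iff_of_isSurjection (isSurjection_of_section D.self_act)]

lemma isOpenSurjection (hπ : IsOpenSurjection π) (hτ : IsColimit (Cofork.ofπ τ w)) :
    IsOpenSurjection τ := by
  have hτ_surj := (isSurjection_and_range_of_isColimit hτ).1
  obtain ⟨l, gc, hl⟩ := exists_directImage hπ hτ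
  refine ⟨⟨l, gc, fun y q => hτ_surj ?_⟩, hτ_surj⟩
  rw [hl, map_inf, map_inf, hl, ← directImage_inf, ← invImage_comp, ← invImage_comp, w]

lemma exists_comp_eq_act (hπ : IsOpenSurjection π) (hτ : IsColimit (Cofork.ofπ τ w)) {ρ : Q ⟶ B}
    (hρ : τ ≫ ρ = φ ≫ π) : ∃ j : pullback π ρ ⟶ Y, pullbackMapSnd π τ hρ ≫ j = D.act := by
  have hs := (hπ.pullback_snd (φ ≫ π)).isOpenMap
  set e := pullbackMapSnd π τ hρ
  let n := pullback.snd π (pullback.snd π (φ ≫ π) ≫ φ ≫ π)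
  have hm : IsOpenSurjection (forgetMiddle π φ) := (hπ.pullback_snd (φ ≫ π)).pullbackMapSnd π rfl
  have forget_e : D.actSnd ≫ e = forgetMiddle π φ ≫ e := by
    apply pullback.hom_ext <;>
      simp [e, actSnd, forgetMiddle, w, reassoc_of% @pullbackMapSnd_snd]
  have act_snd : D.actSnd ≫ pullback.snd π (φ ≫ π) = n ≫ D.act := by simp [actSnd, n]
  obtain ⟨l, -, hl⟩ := exists_directImage hπ hτ
  refine exists_comp_eq_of_isSurjection
    ((isOpenSurjection hπ hτ).pullbackMapSnd π hρ).isSurjection _ fun z => ?_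
  obtain ⟨R, hR⟩ := exists_eq_iSup_of_isPullback (isPullback_pullbackMapSnd π τ hρ)
    (invImage D.act z)
  have direct_act (y : Y) : directImage hm.isOpenMap (invImage n (invImage D.act y)) =
      invImage (pullback.snd π (φ ≫ π)) (directImage hs (invImage D.act y)) :=
    directImage_invImage_of_isPullback (isPullback_pullbackMapSnd π _ rfl).flip hs hm.isOpenMap _
  have rectangle (v : (pullback π ρ : Locale.{u})) (y : Y) :
      directImage hm.isOpenMap (invImage D.actSnd
        (invImage e v ⊓ invImage (pullback.snd π (φ ≫ π)) y)) =
      invImage e (v ⊓ invImage (pullback.snd π ρ) (l y)) :=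
    calc
      _ = directImage hm.isOpenMap (invImage n (invImage D.act y) ⊓
            invImage (forgetMiddle π φ) (invImage e v)) := by
        rw [map_inf, ← invImage_comp, ← invImage_comp, ← invImage_comp, ← invImage_comp, forget_e,
          act_snd, inf_comm]
      _ = invImage e v ⊓ invImage (pullback.snd π (φ ≫ π) ≫ τ) (l y) := by
        rw [directImage_inf, direct_act, inf_comm, invImage_comp _ τ, hl]
      _ = _ := by rw [map_inf, ← invImage_comp e, pullbackMapSnd_snd]
  refine ⟨⨆ x ∈ R, x.1 ⊓ invImage (pullback.snd π ρ) (l x.2), ?_⟩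
  rw [← hm.directImage_invImage (invImage D.act z), ← invImage_comp, ← D.actSnd_act,
    invImage_comp, hR]
  simp only [map_iSup, (directImage_gc hm.isOpenMap).l_iSup]
  exact biSup_congr fun x _ => (rectangle x.1 x.2).symm

theorem isPullback (hπ : IsOpenSurjection π) (hτ : IsColimit (Cofork.ofπ τ w)) {ρ : Q ⟶ B}
    (hρ : τ ≫ ρ = φ ≫ π) : IsPullback φ τ π ρ := by
  obtain ⟨j, hj⟩ := exists_comp_eq_act hπ hτ hρ
  let k : Y ⟶ pullback π ρ := pullback.lift φ τ hρ.symm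
  have hkj : k ≫ j = 𝟙 Y := by
    have : k = pullback.lift φ (𝟙 Y) (by simp) ≫ pullbackMapSnd π τ hρ := by
      apply pullback.hom_ext <;> simp [k]
    rw [this, Category.assoc, hj, D.self_act]
  have hjk : j ≫ k = 𝟙 _ := by
    have := ((isOpenSurjection hπ hτ).pullbackMapSnd π hρ).epi
    rw [← cancel_epi (pullbackMapSnd π τ hρ), reassoc_of% hj, Category.comp_id]
    apply pullback.hom_ext
    · simp [k, D.act_comp]
    · simp [k, w]
  exact IsPullback.of_iso_pullback ⟨hρ.symm⟩ ⟨k, j, hkj, hjk⟩ (pullback.lift_fst _ _ _)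
    (pullback.lift_snd _ _ _)

end Quotient

end DescentDatum

/-! ### Groupoids and actions on generalized elements -/

namespace OpenGroupoid

variable {G : OpenGroupoid.{u}} {Z : Locale.{u}}

variable (G) in
/-- The product of generalized elements of the locale of arrows of a groupoid. -/
noncomputable def mul (g h : Z ⟶ G.G₁) (w : g ≫ G.r = h ≫ G.d) : Z ⟶ G.G₁ :=
  pullback.lift g h w ≫ G.m

@[simp]
lemma mul_d (g h : Z ⟶ G.G₁) (w : g ≫ G.r = h ≫ G.d) : G.mul g h w ≫ G.d = g ≫ G.d := by
  simp [mul, G.m_d]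

@[simp]
lemma mul_r (g h : Z ⟶ G.G₁) (w : g ≫ G.r = h ≫ G.d) : G.mul g h w ≫ G.r = h ≫ G.r := by
  simp [mul, G.m_r]

lemma mul_mul (f g h : Z ⟶ G.G₁) (w₁ : f ≫ G.r = g ≫ G.d) (w₂ : g ≫ G.r = h ≫ G.d) :
    G.mul (G.mul f g w₁) h (by simp [w₂]) = G.mul f (G.mul g h w₂) (by simp [w₁]) :=
  G.mul_assoc f g h w₁ w₂

lemma unit_mul (g : Z ⟶ G.G₁) : G.mul (g ≫ G.d ≫ G.u) g (by simp [G.u_r]) = g := by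
  simpa only [mul, comp_pullback_lift_assoc, Category.comp_id] using g ≫= G.one_mul

lemma mul_unit (g : Z ⟶ G.G₁) : G.mul g (g ≫ G.r ≫ G.u) (by simp [G.u_d]) = g := by
  simpa only [mul, comp_pullback_lift_assoc, Category.comp_id] using g ≫= G.mul_one

lemma inv_mul_self (g : Z ⟶ G.G₁) : G.mul (g ≫ G.i) g (by simp [G.i_r]) = g ≫ G.r ≫ G.u := by
  simpa only [mul, comp_pullback_lift_assoc, Category.comp_id] using g ≫= G.inv_mul

lemma mul_inv_self (g : Z ⟶ G.G₁) : G.mul g (g ≫ G.i) (by simp [G.i_d]) = g ≫ G.d ≫ G.u := by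
  simpa only [mul, comp_pullback_lift_assoc, Category.comp_id] using g ≫= G.mul_inv

end OpenGroupoid

namespace LeftAction

variable {G : OpenGroupoid.{u}} {X M Z Z' : Locale.{u}} {S : LeftAction G X}

variable (S) in
/-- The left action on generalized elements. -/
noncomputable def smul (g : Z ⟶ G.G₁) (x : Z ⟶ X) (w : g ≫ G.r = x ≫ S.p) : Z ⟶ X :=
  pullback.lift g x w ≫ S.act

@[simp]
lemma smul_p (g : Z ⟶ G.G₁) (x : Z ⟶ X) (w : g ≫ G.r = x ≫ S.p) :
    S.smul g x w ≫ S.p = g ≫ G.d := by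
  simp [smul, S.act_p]

lemma comp_smul (f : Z' ⟶ Z) (g : Z ⟶ G.G₁) (x : Z ⟶ X) (w : g ≫ G.r = x ≫ S.p) :
    f ≫ S.smul g x w = S.smul (f ≫ g) (f ≫ x) (by simp [w]) :=
  comp_pullback_lift_assoc f g x w S.act

lemma comp_act (c : Z ⟶ pullback G.r S.p) :
    c ≫ S.act = S.smul (c ≫ pullback.fst _ _) (c ≫ pullback.snd _ _)
      (by simp [pullback.condition]) := by
  rw [smul]
  congr 1
  apply pullback.hom_ext <;> simp

lemma mul_smul (g g' : Z ⟶ G.G₁) (x : Z ⟶ X) (w₁ : g ≫ G.r = g' ≫ G.d)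
    (w₂ : g' ≫ G.r = x ≫ S.p) :
    S.smul (G.mul g g' w₁) x (by simp [w₂]) = S.smul g (S.smul g' x w₂) (by simp [w₁]) :=
  S.mul_act g g' x w₁ w₂

lemma one_smul (x : Z ⟶ X) : S.smul (x ≫ S.p ≫ G.u) x (by simp [G.u_r]) = x := by
  simpa only [smul, comp_pullback_lift_assoc, Category.comp_id] using x ≫= S.one_act

namespace IsPrincipalBundle

variable {π : X ⟶ M}

section

variable (hS : S.IsPrincipalBundle π)

include hS

lemma isOpenSurjection : IsOpenSurjection π := ⟨hS.isOpenMap, hS.isSurjection⟩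

lemma smul_comp (g : Z ⟶ G.G₁) (x : Z ⟶ X) (w : g ≫ G.r = x ≫ S.p) :
    S.smul g x w ≫ π = x ≫ π := by
  simp [smul, hS.invariant]

lemma free {g g' : Z ⟶ G.G₁} {x : Z ⟶ X} {w : g ≫ G.r = x ≫ S.p} {w' : g' ≫ G.r = x ≫ S.p}
    (h : S.smul g x w = S.smul g' x w') : g = g' := by
  have := hS.isIso_pairing
  have h' : pullback.lift g x w = pullback.lift g' x w' := by
    rw [← cancel_mono (pullback.lift S.act (pullback.snd G.r S.p) hS.invariant : _ ⟶ pullback π π)]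
    apply pullback.hom_ext
    · simpa [smul] using h
    · simp
  simpa using h' =≫ pullback.fst _ _

lemma exists_smul_eq (x y : Z ⟶ X) (h : x ≫ π = y ≫ π) :
    ∃ (g : Z ⟶ G.G₁) (w : g ≫ G.r = y ≫ S.p), S.smul g y w = x := by
  have := hS.isIso_pairing
  let f : _ ⟶ pullback π π := pullback.lift S.act (pullback.snd G.r S.p) hS.invariant
  let z := pullback.lift x y h ≫ inv f
  have hz : z ≫ f = pullback.lift x y h := by simp [z]
  have z_act : z ≫ S.act = x := by simpa [f] using hz =≫ pullback.fst π π
  have z_snd : z ≫ pullback.snd G.r S.p = y := by simpa [f] using hz =≫ pullback.snd π π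
  simp only [comp_act, z_snd] at z_act
  exact ⟨_, _, z_act⟩

end

/-- The division map of a principal bundle: the unique `g` with `g y = x`, for generalized elements
`x` and `y` in the same fibre. -/
noncomputable def div (hS : S.IsPrincipalBundle π) (x y : Z ⟶ X) (h : x ≫ π = y ≫ π) : Z ⟶ G.G₁ :=
  (hS.exists_smul_eq x y h).choose

section

variable (hS : S.IsPrincipalBundle π) {x y z : Z ⟶ X}

@[simp]
lemma div_r (h : x ≫ π = y ≫ π) : hS.div x y h ≫ G.r = y ≫ S.p :=
  (hS.exists_smul_eq x y h).choose_spec.choose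

@[simp]
lemma smul_div (h : x ≫ π = y ≫ π) : S.smul (hS.div x y h) y (hS.div_r h) = x :=
  (hS.exists_smul_eq x y h).choose_spec.choose_spec

@[simp]
lemma div_d (h : x ≫ π = y ≫ π) : hS.div x y h ≫ G.d = x ≫ S.p := by
  rw [← smul_p _ _ (hS.div_r h), smul_div]

lemma eq_div {g : Z ⟶ G.G₁} {w : g ≫ G.r = y ≫ S.p} (h : S.smul g y w = x) :
    g = hS.div x y (by rw [← h, hS.smul_comp]) :=
  hS.free (h.trans (hS.smul_div _).symm)

lemma comp_div (f : Z' ⟶ Z) (h : x ≫ π = y ≫ π) :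
    f ≫ hS.div x y h = hS.div (f ≫ x) (f ≫ y) (by simp [h]) :=
  hS.eq_div (w := by simp) (by rw [← comp_smul f _ _ (hS.div_r h), smul_div])

lemma div_self : hS.div x x rfl = x ≫ S.p ≫ G.u :=
  (hS.eq_div (one_smul x)).symm

lemma div_mul_div (h : x ≫ π = y ≫ π) (h' : y ≫ π = z ≫ π) :
    G.mul (hS.div x y h) (hS.div y z h') (by simp) = hS.div x z (h.trans h') :=
  hS.eq_div (w := by simp) (by rw [mul_smul _ _ _ _ (hS.div_r h')]; simp only [smul_div])

end

lemma of_free_of_local {π : X ⟶ M} (invariant : S.act ≫ π = pullback.snd _ _ ≫ π)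
    (hπ : IsOpenSurjection π)
    (free : ∀ {Z : Locale.{u}} (g g' : Z ⟶ G.G₁) (x : Z ⟶ X) (w : g ≫ G.r = x ≫ S.p)
      (w' : g' ≫ G.r = x ≫ S.p), S.smul g x w = S.smul g' x w' → g = g')
    (trans : ∀ {Z : Locale.{u}} (x y : Z ⟶ X), x ≫ π = y ≫ π →
      ∃ (Z' : Locale.{u}) (ζ : Z' ⟶ Z) (g : Z' ⟶ G.G₁) (w : g ≫ G.r = (ζ ≫ y) ≫ S.p),
        IsOpenSurjection ζ ∧ S.smul g (ζ ≫ y) w = ζ ≫ x) :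
    S.IsPrincipalBundle π := by
  let f : _ ⟶ pullback π π := pullback.lift S.act (pullback.snd G.r S.p) invariant
  have : Mono f := ⟨fun a b h => by
    have h_act : a ≫ S.act = b ≫ S.act := by simpa [f] using h =≫ pullback.fst π π
    have h_snd : a ≫ pullback.snd _ _ = b ≫ pullback.snd _ _ := by
      simpa [f] using h =≫ pullback.snd π π
    simp only [comp_act, h_snd] at h_act
    exact pullback.hom_ext (free _ _ _ _ _ h_act) h_snd⟩
  obtain ⟨Z', ζ, g, w, hζ, h⟩ := trans (pullback.fst π π) (pullback.snd π π) pullback.condition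
  refine ⟨invariant, hζ.isIso_of_mono (f := f) (pullback.lift g _ w) ?_, hπ.1, hπ.2⟩
  apply pullback.hom_ext
  · simpa [f, smul] using h
  · simp [f]

end IsPrincipalBundle

end LeftAction

namespace RightAction

variable {H : OpenGroupoid.{u}} {X Z Z' : Locale.{u}} {S : RightAction H X}

variable (S) in
/-- The right action on generalized elements. -/
noncomputable def rmul (x : Z ⟶ X) (h : Z ⟶ H.G₁) (w : x ≫ S.q = h ≫ H.d) : Z ⟶ X :=
  pullback.lift x h w ≫ S.ract

@[simp]
lemma rmul_q (x : Z ⟶ X) (h : Z ⟶ H.G₁) (w : x ≫ S.q = h ≫ H.d) :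
    S.rmul x h w ≫ S.q = h ≫ H.r := by
  simp [rmul, S.ract_q]

lemma comp_rmul (f : Z' ⟶ Z) (x : Z ⟶ X) (h : Z ⟶ H.G₁) (w : x ≫ S.q = h ≫ H.d) :
    f ≫ S.rmul x h w = S.rmul (f ≫ x) (f ≫ h) (by simp [w]) :=
  comp_pullback_lift_assoc f x h w S.ract

lemma comp_ract (c : Z ⟶ pullback S.q H.d) :
    c ≫ S.ract = S.rmul (c ≫ pullback.fst _ _) (c ≫ pullback.snd _ _)
      (by simp [pullback.condition]) := by
  rw [rmul]
  congr 1
  apply pullback.hom_ext <;> simp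

lemma rmul_rmul (x : Z ⟶ X) (h h' : Z ⟶ H.G₁) (w₁ : x ≫ S.q = h ≫ H.d)
    (w₂ : h ≫ H.r = h' ≫ H.d) :
    S.rmul (S.rmul x h w₁) h' (by simp [w₂]) = S.rmul x (H.mul h h' w₂) (by simp [w₁]) :=
  S.ract_mul x h h' w₁ w₂

lemma rmul_one (x : Z ⟶ X) : S.rmul x (x ≫ S.q ≫ H.u) (by simp [H.u_d]) = x := by
  simpa only [rmul, comp_pullback_lift_assoc, Category.comp_id] using x ≫= S.ract_one

end RightAction

namespace BilocaleStr

variable {G H K : OpenGroupoid.{u}} {X X' Z Z' : Locale.{u}} {S : BilocaleStr G H X}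
  {S' : BilocaleStr H K X'}

@[simp]
lemma smul_q (g : Z ⟶ G.G₁) (x : Z ⟶ X) (w : g ≫ G.r = x ≫ S.p) :
    S.smul g x w ≫ S.q = x ≫ S.q := by
  simp [LeftAction.smul, S.act_q]

@[simp]
lemma rmul_p (x : Z ⟶ X) (h : Z ⟶ H.G₁) (w : x ≫ S.q = h ≫ H.d) :
    S.rmul x h w ≫ S.p = x ≫ S.p := by
  simp [RightAction.rmul, S.ract_p]

lemma smul_rmul (g : Z ⟶ G.G₁) (x : Z ⟶ X) (h : Z ⟶ H.G₁)
    (w₁ : g ≫ G.r = x ≫ S.p) (w₂ : x ≫ S.q = h ≫ H.d) :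
    S.rmul (S.smul g x w₁) h (by simp [w₂]) = S.smul g (S.rmul x h w₂) (by simp [w₁]) :=
  S.act_ract g x h w₁ w₂

variable (S S') in
/-- The tensor `x ⊗ x'` of generalized elements. -/
noncomputable def tens (x : Z ⟶ X) (x' : Z ⟶ X') (w : x ≫ S.q = x' ≫ S'.p) : Z ⟶ tensor S S' :=
  pullback.lift x x' w ≫ tensorProj S S'

lemma comp_tens (f : Z' ⟶ Z) (x : Z ⟶ X) (x' : Z ⟶ X') (w : x ≫ S.q = x' ≫ S'.p) :
    f ≫ tens S S' x x' w = tens S S' (f ≫ x) (f ≫ x') (by simp [w]) :=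
  comp_pullback_lift_assoc f x x' w (tensorProj S S')

lemma comp_tensorProj (c : Z ⟶ pullback S.q S'.p) :
    c ≫ tensorProj S S' = tens S S' (c ≫ pullback.fst _ _) (c ≫ pullback.snd _ _)
      (by simp [pullback.condition]) := by
  rw [tens]
  congr 1
  apply pullback.hom_ext <;> simp

lemma rmul_tens (x : Z ⟶ X) (h : Z ⟶ H.G₁) (x' : Z ⟶ X') (w₁ : x ≫ S.q = h ≫ H.d)
    (w₂ : h ≫ H.r = x' ≫ S'.p) :
    tens S S' (S.rmul x h w₁) x' (by simp [w₂]) = tens S S' x (S'.smul h x' w₂) (by simp [w₁]) := by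
  have left : pullback.lift (pullback.lift x h w₁) x' (by simp [w₂]) ≫ tensorLeft S S' =
      pullback.lift (S.rmul x h w₁) x' (by simp [w₂]) := by
    simp [tensorLeft, comp_pullback_lift, RightAction.rmul]
  have right : pullback.lift (pullback.lift x h w₁) x' (by simp [w₂]) ≫ tensorRight S S' =
      pullback.lift x (S'.smul h x' w₂) (by simp [w₁]) := by
    simp [tensorRight, comp_pullback_lift, comp_pullback_lift_assoc, LeftAction.smul]
  rw [tens, ← left, tens, ← right, Category.assoc, Category.assoc]
  exact _ ≫= coequalizer.condition (tensorLeft S S') (tensorRight S S')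

end BilocaleStr

/-! ### The tensor product as a quotient -/

namespace BilocaleStr

variable {G H K : OpenGroupoid.{u}} {X X' Z : Locale.{u}} {S : BilocaleStr G H X}
  {S' : BilocaleStr H K X'}

variable (S S') in
/-- The `G`-`K`-bilocale `X ×_{H₀} X'`, with `g (x, x') = (g x, x')` and `(x, x') k = (x, x' k)`. -/
noncomputable def prod : BilocaleStr G K (pullback S.q S'.p) where
  p := pullback.fst _ _ ≫ S.p
  act := pullback.lift (S.smul (pullback.fst _ _) (pullback.snd _ _ ≫ pullback.fst _ _)
    (by simp [pullback.condition])) (pullback.snd _ _ ≫ pullback.snd _ _)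
    (by simp [pullback.condition])
  act_p := by simp
  mul_act g g' x w₁ w₂ := by
    have := S.mul_smul g g' (x ≫ pullback.fst _ _) w₁ (by simpa using w₂)
    simp [comp_pullback_lift, LeftAction.comp_smul, ← this, OpenGroupoid.mul]
  one_act := by
    have := S.one_smul (pullback.fst S.q S'.p)
    apply pullback.hom_ext <;> simp [LeftAction.comp_smul, this]
  q := pullback.snd _ _ ≫ S'.q
  ract := pullback.lift (pullback.fst _ _ ≫ pullback.fst _ _)
    (S'.rmul (pullback.fst _ _ ≫ pullback.snd _ _) (pullback.snd _ _)
      (by simp [pullback.condition])) (by simp [pullback.condition])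
  ract_q := by simp
  ract_mul x h h' w₁ w₂ := by
    have := S'.rmul_rmul (x ≫ pullback.snd _ _) h h' (by simpa using w₁) w₂
    simp [comp_pullback_lift, RightAction.comp_rmul, this, OpenGroupoid.mul]
  ract_one := by
    have := S'.rmul_one (pullback.snd S.q S'.p)
    apply pullback.hom_ext <;> simp [RightAction.comp_rmul, this]
  act_q := by simp
  ract_p := by simp
  act_ract g x h w₁ w₂ := by
    simp [comp_pullback_lift, LeftAction.comp_smul, RightAction.comp_rmul]

variable (S S') in
/-- The anchor map `x ⊗ x' ↦ q x'` of the tensor product. -/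
noncomputable def tensorQ : tensor S S' ⟶ K.G₀ :=
  coequalizer.desc (pullback.snd _ _ ≫ S'.q) (by simp [tensorLeft, tensorRight, S'.act_q])

lemma tensorProj_tensorQ : tensorProj S S' ≫ tensorQ S S' = pullback.snd _ _ ≫ S'.q :=
  coequalizer.π_desc _ _

variable (S) in
/-- If `X'` is principal over `K₀`, then `X ×_{H₀} X' ⟶ X'` carries the descent datum along
`q : X' ⟶ K₀` given by `e • (x, x') = (x h, e)`, where `h e = x'`. -/
noncomputable def tensorDescent (hS' : S'.IsPrincipalBundle S'.q) :
    DescentDatum S'.q (pullback.snd S.q S'.p) where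
  act := pullback.lift
    (S.rmul (pullback.snd _ _ ≫ pullback.fst _ _)
      (hS'.div (pullback.snd _ _ ≫ pullback.snd _ _) (pullback.fst _ _)
        (by simp [pullback.condition]))
      (by simp [pullback.condition]))
    (pullback.fst _ _) (by simp)
  act_comp := by simp
  self_act := by
    have := S.rmul_one (pullback.fst S.q S'.p)
    apply pullback.hom_ext
    · simpa [RightAction.comp_rmul, hS'.comp_div, hS'.div_self, pullback.condition_assoc]
    · simp
  act_act e e' y w w' := by
    have := S.rmul_rmul (y ≫ pullback.fst _ _) (hS'.div (y ≫ pullback.snd _ _) e' (by simp [w']))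
      (hS'.div e' e w.symm) (by simp [pullback.condition]) (by simp)
    apply pullback.hom_ext
    · simpa [RightAction.comp_rmul, hS'.comp_div, hS'.div_mul_div] using this
    · simp

lemma tensorDescent_act (hS' : S'.IsPrincipalBundle S'.q) :
    (tensorDescent S hS').act ≫ tensorProj S S' = pullback.snd _ _ ≫ tensorProj S S' := by
  have hq : (pullback.snd S'.q (pullback.snd S.q S'.p ≫ S'.q) ≫ pullback.snd S.q S'.p) ≫ S'.q =
      pullback.fst _ _ ≫ S'.q := by simp [pullback.condition]
  have h := rmul_tens (S := S) (S' := S')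
    (pullback.snd S'.q (pullback.snd S.q S'.p ≫ S'.q) ≫ pullback.fst S.q S'.p) (hS'.div _ _ hq)
    (pullback.fst _ _) (by simp [pullback.condition]) (by simp)
  simpa [comp_tensorProj, tensorDescent] using h

lemma isColimit_tensorProj (hS' : S'.IsPrincipalBundle S'.q) :
    Nonempty (IsColimit (Cofork.ofπ (tensorProj S S') (tensorDescent_act (S := S) hS'))) := by
  -- `k (x, h, x') = (x', (x, h x'))`, and `x'` acts on `(x, h x')` through `(h x') / x' = h`.
  let k : _ ⟶ pullback S'.q (pullback.snd S.q S'.p ≫ S'.q) :=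
    pullback.lift (pullback.snd _ _) (tensorRight S S') (by simp [tensorRight, S'.act_q])
  have k_snd : k ≫ pullback.snd _ _ = tensorRight S S' := pullback.lift_snd _ _ _
  have k_act : k ≫ (tensorDescent S hS').act = tensorLeft S S' := by
    have h_div := hS'.eq_div (g := pullback.fst _ _ ≫ pullback.snd _ _) (y := pullback.snd _ _)
      (w := by simp [pullback.condition])
      (x := tensorRight S S' ≫ pullback.snd _ _) (by simp [tensorRight, LeftAction.smul])
    apply pullback.hom_ext
    · have tensorRight_fst : tensorRight S S' ≫ pullback.fst _ _ =
          pullback.fst _ _ ≫ pullback.fst _ _ := pullback.lift_fst _ _ _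
      simp [k, tensorDescent, RightAction.comp_rmul, hS'.comp_div, ← h_div, tensorRight_fst,
        tensorLeft, RightAction.comp_ract]
    · simp [k, tensorDescent, tensorLeft]
  refine ⟨Cofork.IsColimit.mk _ (fun s => coequalizer.desc s.π ?_)
    (fun s => coequalizer.π_desc _ _) fun s m hm => ?_⟩
  · have := k ≫= s.condition
    rwa [reassoc_of% k_act, reassoc_of% k_snd] at this
  · exact coequalizer.hom_ext (hm.trans (coequalizer.π_desc _ _).symm)

lemma isOpenSurjection_tensorProj (hS' : S'.IsPrincipalBundle S'.q) :
    IsOpenSurjection (tensorProj S S') := by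
  obtain ⟨h⟩ := isColimit_tensorProj (S := S) hS'
  exact DescentDatum.isOpenSurjection hS'.isOpenSurjection h

lemma isPullback_tensorProj (hS' : S'.IsPrincipalBundle S'.q) :
    IsPullback (pullback.snd S.q S'.p) (tensorProj S S') S'.q (tensorQ S S') := by
  obtain ⟨h⟩ := isColimit_tensorProj (S := S) hS'
  exact DescentDatum.isPullback hS'.isOpenSurjection h tensorProj_tensorQ

lemma exists_of_tens_eq (hS' : S'.IsPrincipalBundle S'.q) {x y : Z ⟶ X} {x' y' : Z ⟶ X'}
    {w : x ≫ S.q = x' ≫ S'.p} {w' : y ≫ S.q = y' ≫ S'.p}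
    (h : tens S S' x x' w = tens S S' y y' w') :
    ∃ (k : Z ⟶ H.G₁) (w₁ : y ≫ S.q = k ≫ H.d) (w₂ : k ≫ H.r = x' ≫ S'.p),
      x = S.rmul y k w₁ ∧ S'.smul k x' w₂ = y' := by
  have hq : y' ≫ S'.q = x' ≫ S'.q := by
    simpa [tens, tensorProj_tensorQ] using (h =≫ tensorQ S S').symm
  have w₁ : y ≫ S.q = hS'.div y' x' hq ≫ H.d := by rw [hS'.div_d, w']
  refine ⟨hS'.div y' x' hq, w₁, hS'.div_r hq, ?_, hS'.smul_div hq⟩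
  have h_lift : pullback.lift x x' w = pullback.lift (S.rmul y _ w₁) x' (by simp) := by
    refine (isPullback_tensorProj hS').hom_ext (by simp) (h.trans ?_)
    refine Eq.trans ?_ (rmul_tens y _ x' w₁ (hS'.div_r hq)).symm
    simp only [hS'.smul_div]
  simpa using h_lift =≫ pullback.fst _ _

end BilocaleStr

/-! ### Quotients of bilocales -/

lemma IsOpenSurjection.exists_local_lift {X Q Z : Locale.{u}} {π : X ⟶ Q}
    (hπ : IsOpenSurjection π) (t : Z ⟶ Q) :
    ∃ (Z' : Locale.{u}) (ζ : Z' ⟶ Z) (x : Z' ⟶ X), IsOpenSurjection ζ ∧ ζ ≫ t = x ≫ π :=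
  ⟨_, pullback.fst t π, pullback.snd t π, hπ.pullback_fst t, pullback.condition⟩

namespace LeftAction

variable {G : OpenGroupoid.{u}} {X Q Z : Locale.{u}} {S : LeftAction G X} {f : X ⟶ Q}

lemma smul_comp_of_equivariant {T : LeftAction G Q} (hp : f ≫ T.p = S.p)
    (hact : S.act ≫ f = pullbackMapSnd G.r f hp ≫ T.act) (g : Z ⟶ G.G₁) (x : Z ⟶ X)
    (w : g ≫ G.r = x ≫ S.p) :
    S.smul g x w ≫ f = T.smul g (x ≫ f) (by simp [hp, w]) := by
  simp [smul, hact, pullbackMapSnd, comp_pullback_lift_assoc]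

lemma exists_descent (hf : IsOpenSurjection f)
    (p_eq : ∀ {Z : Locale.{u}} (x y : Z ⟶ X), x ≫ f = y ≫ f → x ≫ S.p = y ≫ S.p)
    (smul_eq : ∀ {Z : Locale.{u}} (g : Z ⟶ G.G₁) (x y : Z ⟶ X) (w : g ≫ G.r = x ≫ S.p)
      (w' : g ≫ G.r = y ≫ S.p), x ≫ f = y ≫ f → S.smul g x w ≫ f = S.smul g y w' ≫ f) :
    ∃ (T : LeftAction G Q) (hp : f ≫ T.p = S.p),
      S.act ≫ f = pullbackMapSnd G.r f hp ≫ T.act := by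
  obtain ⟨p, hp⟩ := hf.exists_desc S.p p_eq
  have hmap := hf.pullbackMapSnd G.r hp
  have := hmap.epi
  obtain ⟨act, hact⟩ := hmap.exists_desc (S.act ≫ f) fun a b h => by
    have h_fst : a ≫ pullback.fst _ _ = b ≫ pullback.fst _ _ := by
      simpa using h =≫ pullback.fst _ _
    have h_snd : (a ≫ pullback.snd _ _) ≫ f = (b ≫ pullback.snd _ _) ≫ f := by
      simpa using h =≫ pullback.snd _ _
    rw [← Category.assoc, ← Category.assoc, comp_act, comp_act]
    simp only [h_fst]
    exact smul_eq _ _ _ _ _ h_snd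
  have lift_act {Z : Locale.{u}} (g : Z ⟶ G.G₁) (x : Z ⟶ X)
      (w : g ≫ G.r = (x ≫ f) ≫ p) :
      pullback.lift g (x ≫ f) w ≫ act = S.smul g x (by simpa [hp] using w) ≫ f := by
    simp [smul, ← hact, pullbackMapSnd, comp_pullback_lift_assoc]
  refine ⟨⟨p, act, ?_, fun g g' t w₁ w₂ => ?_, ?_⟩, hp, hact.symm⟩
  · rw [← cancel_epi (pullbackMapSnd G.r f hp), reassoc_of% hact, hp, S.act_p,
      reassoc_of% @pullbackMapSnd_fst]
  · obtain ⟨Z', ζ, x, hζ, hx⟩ := hf.exists_local_lift t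
    have := hζ.epi
    have hw : (ζ ≫ g') ≫ G.r = x ≫ S.p := by
      rw [Category.assoc, w₂, reassoc_of% hx, hp]
    have := S.mul_smul (ζ ≫ g) (ζ ≫ g') x (by simp [w₁]) hw
    rw [← cancel_epi ζ]
    simp [comp_pullback_lift_assoc, hx, lift_act, ← this, OpenGroupoid.mul]
  · have := hf.epi
    rw [← cancel_epi f]
    have lift_unit := lift_act (S.p ≫ G.u) (𝟙 X) (by simp [hp, G.u_r])
    have := S.one_smul (𝟙 X)
    simp only [Category.id_comp] at this lift_unit
    simp [comp_pullback_lift_assoc, reassoc_of% hp, lift_unit, this]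

end LeftAction

namespace RightAction

variable {H : OpenGroupoid.{u}} {X Q Z : Locale.{u}} {S : RightAction H X} {f : X ⟶ Q}

lemma rmul_comp_of_equivariant {T : RightAction H Q} (hq : f ≫ T.q = S.q)
    (hract : S.ract ≫ f = pullbackMapFst H.d f hq ≫ T.ract) (x : Z ⟶ X) (h : Z ⟶ H.G₁)
    (w : x ≫ S.q = h ≫ H.d) :
    S.rmul x h w ≫ f = T.rmul (x ≫ f) h (by simp [hq, w]) := by
  simp [rmul, hract, pullbackMapFst, comp_pullback_lift_assoc]

lemma exists_descent (hf : IsOpenSurjection f)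
    (q_eq : ∀ {Z : Locale.{u}} (x y : Z ⟶ X), x ≫ f = y ≫ f → x ≫ S.q = y ≫ S.q)
    (rmul_eq : ∀ {Z : Locale.{u}} (x y : Z ⟶ X) (h : Z ⟶ H.G₁) (w : x ≫ S.q = h ≫ H.d)
      (w' : y ≫ S.q = h ≫ H.d), x ≫ f = y ≫ f → S.rmul x h w ≫ f = S.rmul y h w' ≫ f) :
    ∃ (T : RightAction H Q) (hq : f ≫ T.q = S.q),
      S.ract ≫ f = pullbackMapFst H.d f hq ≫ T.ract := by
  obtain ⟨q, hq⟩ := hf.exists_desc S.q q_eq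
  have hmap := hf.pullbackMapFst H.d hq
  have := hmap.epi
  obtain ⟨ract, hract⟩ := hmap.exists_desc (S.ract ≫ f) fun a b h => by
    have h_fst : (a ≫ pullback.fst _ _) ≫ f = (b ≫ pullback.fst _ _) ≫ f := by
      simpa using h =≫ pullback.fst _ _
    have h_snd : a ≫ pullback.snd _ _ = b ≫ pullback.snd _ _ := by
      simpa using h =≫ pullback.snd _ _
    rw [← Category.assoc, ← Category.assoc, comp_ract, comp_ract]
    simp only [h_snd]
    exact rmul_eq _ _ _ _ _ h_fst
  have lift_ract {Z : Locale.{u}} (x : Z ⟶ X) (h : Z ⟶ H.G₁)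
      (w : (x ≫ f) ≫ q = h ≫ H.d) :
      pullback.lift (x ≫ f) h w ≫ ract = S.rmul x h (by simpa [hq] using w) ≫ f := by
    simp [rmul, ← hract, pullbackMapFst, comp_pullback_lift_assoc]
  refine ⟨⟨q, ract, ?_, fun t h h' w₁ w₂ => ?_, ?_⟩, hq, hract.symm⟩
  · rw [← cancel_epi (pullbackMapFst H.d f hq), reassoc_of% hract, hq, S.ract_q,
      reassoc_of% @pullbackMapFst_snd]
  · obtain ⟨Z', ζ, x, hζ, hx⟩ := hf.exists_local_lift t
    have := hζ.epi
    have hw : x ≫ S.q = (ζ ≫ h) ≫ H.d := by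
      rw [Category.assoc, ← w₁, reassoc_of% hx, hq]
    have := S.rmul_rmul x (ζ ≫ h) (ζ ≫ h') hw (by simp [w₂])
    rw [← cancel_epi ζ]
    simp [comp_pullback_lift_assoc, hx, lift_ract, this, OpenGroupoid.mul]
  · have := hf.epi
    rw [← cancel_epi f]
    have lift_unit := lift_ract (𝟙 X) (S.q ≫ H.u) (by simp [hq, H.u_d])
    have := S.rmul_one (𝟙 X)
    simp only [Category.id_comp] at this lift_unit
    simp [comp_pullback_lift_assoc, reassoc_of% hq, lift_unit, this]

end RightAction

namespace Bilocale

variable {G H : OpenGroupoid.{u}} {A B : Bilocale G H} {X Q Z : Locale.{u}}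

lemma Hom.smul_f (φ : Hom A B) (g : Z ⟶ G.G₁) (x : Z ⟶ A.X) (w : g ≫ G.r = x ≫ A.str.p) :
    A.str.smul g x w ≫ φ.f = B.str.smul g (x ≫ φ.f) (by rw [Category.assoc, φ.f_p, w]) :=
  LeftAction.smul_comp_of_equivariant φ.f_p φ.act_f g x w

lemma Hom.rmul_f (φ : Hom A B) (x : Z ⟶ A.X) (h : Z ⟶ H.G₁) (w : x ≫ A.str.q = h ≫ H.d) :
    A.str.rmul x h w ≫ φ.f = B.str.rmul (x ≫ φ.f) h (by rw [Category.assoc, φ.f_q, w]) :=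
  RightAction.rmul_comp_of_equivariant φ.f_q φ.ract_f x h w

theorem Hom.exists_descent {S : BilocaleStr G H X} {f : X ⟶ Q} (hf : IsOpenSurjection f)
    (p_eq : ∀ {Z : Locale.{u}} (x y : Z ⟶ X), x ≫ f = y ≫ f → x ≫ S.p = y ≫ S.p)
    (smul_eq : ∀ {Z : Locale.{u}} (g : Z ⟶ G.G₁) (x y : Z ⟶ X) (w : g ≫ G.r = x ≫ S.p)
      (w' : g ≫ G.r = y ≫ S.p), x ≫ f = y ≫ f → S.smul g x w ≫ f = S.smul g y w' ≫ f)
    (q_eq : ∀ {Z : Locale.{u}} (x y : Z ⟶ X), x ≫ f = y ≫ f → x ≫ S.q = y ≫ S.q)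
    (rmul_eq : ∀ {Z : Locale.{u}} (x y : Z ⟶ X) (h : Z ⟶ H.G₁) (w : x ≫ S.q = h ≫ H.d)
      (w' : y ≫ S.q = h ≫ H.d), x ≫ f = y ≫ f → S.rmul x h w ≫ f = S.rmul y h w' ≫ f) :
    ∃ (T : BilocaleStr G H Q) (φ : Hom ⟨X, S⟩ ⟨Q, T⟩), φ.f = f := by
  obtain ⟨L, hp, hact⟩ := S.toLeftAction.exists_descent hf p_eq smul_eq
  obtain ⟨R, hq, hract⟩ := S.toRightAction.exists_descent hf q_eq rmul_eq
  refine ⟨⟨L, R, ?_, ?_, fun g t h w₁ w₂ => ?_⟩, ⟨f, hp, hq, hact, hract⟩, rfl⟩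
  · have := (hf.pullbackMapSnd G.r hp).epi
    rw [← cancel_epi (pullbackMapSnd G.r f hp), ← reassoc_of% hact, hq, S.act_q,
      reassoc_of% @pullbackMapSnd_snd, hq]
  · have := (hf.pullbackMapFst H.d hq).epi
    rw [← cancel_epi (pullbackMapFst H.d f hq), ← reassoc_of% hract, hp, S.ract_p,
      reassoc_of% @pullbackMapFst_fst, hp]
  · obtain ⟨Z', ζ, x, hζ, hx⟩ := hf.exists_local_lift t
    have := hζ.epi
    have hw₁ : (ζ ≫ g) ≫ G.r = x ≫ S.p := by rw [Category.assoc, w₁, reassoc_of% hx, hp]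
    have hw₂ : x ≫ S.q = (ζ ≫ h) ≫ H.d := by rw [Category.assoc, ← w₂, reassoc_of% hx, hq]
    have key := S.smul_rmul (ζ ≫ g) x (ζ ≫ h) hw₁ hw₂ =≫ f
    simp only [RightAction.rmul_comp_of_equivariant hq hract,
      LeftAction.smul_comp_of_equivariant hp hact] at key
    rw [← cancel_epi ζ]
    simpa [comp_pullback_lift_assoc, hx, LeftAction.smul, RightAction.rmul] using key

end Bilocale

/-! ### Maps out of a quotient bilocale -/

namespace Bilocale

variable {G H : OpenGroupoid.{u}} {A B C : Bilocale G H} {X : Locale.{u}}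

lemma Hom.exists_comp_eq (φ : Hom A B) (hφ : IsOpenSurjection φ.f) (ψ : Hom A C)
    (h : ∀ {Z : Locale.{u}} (a b : Z ⟶ A.X), a ≫ φ.f = b ≫ φ.f → a ≫ ψ.f = b ≫ ψ.f) :
    ∃ χ : Hom B C, φ.f ≫ χ.f = ψ.f := by
  obtain ⟨j, hj⟩ := hφ.exists_desc ψ.f h
  have := hφ.epi
  have hp : j ≫ C.str.p = B.str.p := by
    rw [← cancel_epi φ.f, reassoc_of% hj, ψ.f_p, φ.f_p]
  have hq : j ≫ C.str.q = B.str.q := by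
    rw [← cancel_epi φ.f, reassoc_of% hj, ψ.f_q, φ.f_q]
  have hact : B.str.act ≫ j = pullbackMapSnd G.r j hp ≫ C.str.act := by
    have := (hφ.pullbackMapSnd G.r φ.f_p).epi
    have comp_map : pullbackMapSnd G.r φ.f φ.f_p ≫ pullbackMapSnd G.r j hp =
        pullbackMapSnd G.r ψ.f ψ.f_p := by
      apply pullback.hom_ext <;> simp [reassoc_of% @pullbackMapSnd_snd, hj]
    rw [← cancel_epi (pullbackMapSnd G.r φ.f φ.f_p), reassoc_of% comp_map]
    exact ((reassoc_of% φ.act_f) j).symm.trans ((A.str.act ≫= hj).trans ψ.act_f)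
  have hract : B.str.ract ≫ j = pullbackMapFst H.d j hq ≫ C.str.ract := by
    have := (hφ.pullbackMapFst H.d φ.f_q).epi
    have comp_map : pullbackMapFst H.d φ.f φ.f_q ≫ pullbackMapFst H.d j hq =
        pullbackMapFst H.d ψ.f ψ.f_q := by
      apply pullback.hom_ext <;> simp [reassoc_of% @pullbackMapFst_fst, hj]
    rw [← cancel_epi (pullbackMapFst H.d φ.f φ.f_q), reassoc_of% comp_map]
    exact ((reassoc_of% φ.ract_f) j).symm.trans ((A.str.ract ≫= hj).trans ψ.ract_f)
  exact ⟨⟨j, hp, hq, hact, hract⟩, hj⟩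

lemma Hom.str_eq_of_f_eq_id {S T : BilocaleStr G H X} (φ : Hom ⟨X, S⟩ ⟨X, T⟩) (h : φ.f = 𝟙 X) :
    S = T := by
  obtain ⟨f, f_p, f_q, act_f, ract_f⟩ := φ
  obtain ⟨⟨p, act, _, _, _⟩, ⟨q, ract, _, _, _⟩, _, _, _⟩ := S
  obtain ⟨⟨p', act', _, _, _⟩, ⟨q', ract', _, _, _⟩, _, _, _⟩ := T
  obtain rfl : f = 𝟙 X := h
  obtain rfl : p' = p := (Category.id_comp _).symm.trans f_p
  obtain rfl : q' = q := (Category.id_comp _).symm.trans f_q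
  obtain rfl : act = act' := by simpa using act_f
  obtain rfl : ract = ract' := by simpa using ract_f
  rfl

lemma Hom.nonempty_iso (φ : Hom A B) [IsIso φ.f] : Nonempty (A ≅ B) := by
  obtain ⟨χ, hχ⟩ := φ.exists_comp_eq (.of_isIso φ.f) (𝟙 A : A ⟶ A) fun a b h => by
    rw [(cancel_mono φ.f).1 h]
  refine ⟨φ, χ, Hom.ext hχ, Hom.ext ?_⟩
  rw [← cancel_epi φ.f]
  exact ((reassoc_of% hχ) φ.f).trans ((Category.id_comp _).trans (Category.comp_id _).symm)

lemma Hom.isIso_f (φ : Hom A B) (hA : A.str.IsPrincipal) (hB : B.str.IsPrincipal) :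
    IsIso φ.f := by
  have : Mono φ.f := ⟨fun {Z} a b h => by
    have hq : a ≫ A.str.q = b ≫ A.str.q := by rw [← φ.f_q, reassoc_of% h]
    obtain ⟨g, w, hg⟩ := hA.exists_smul_eq a b hq
    have smul_eq : B.str.smul g (b ≫ φ.f) (by rw [Category.assoc, φ.f_p, w]) = b ≫ φ.f := by
      rw [← φ.smul_f _ _ w, hg, h]
    have hg_unit := hB.free (smul_eq.trans (LeftAction.one_smul (b ≫ φ.f)).symm)
    simp only [Category.assoc, reassoc_of% φ.f_p] at hg_unit
    simp only [← hg, hg_unit, LeftAction.one_smul]⟩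
  let t := pullback.fst A.str.q B.str.q
  obtain ⟨g, w, hg⟩ := hB.exists_smul_eq (pullback.snd A.str.q B.str.q) (t ≫ φ.f)
    (by rw [Category.assoc, φ.f_q, pullback.condition])
  have w' : g ≫ G.r = t ≫ A.str.p := by rw [w, Category.assoc, φ.f_p]
  exact (hA.isOpenSurjection.pullback_snd B.str.q).isIso_of_mono (A.str.smul g t w')
    ((φ.smul_f g t w').trans hg)

end Bilocale

namespace HSMap

variable {G H : OpenGroupoid.{u}} {X Y Z : Locale.{u}} {R : BilocaleStr G H X}
  {S : BilocaleStr G H Y} {T : BilocaleStr G H Z}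

lemma mk_eq_of_hom (hS : S.IsPrincipal) (hT : T.IsPrincipal) (φ : Bilocale.Hom ⟨Y, S⟩ ⟨Z, T⟩) :
    mk S hS = mk T hT := by
  have := φ.isIso_f hS hT
  obtain ⟨e⟩ := φ.nonempty_iso
  exact Quotient.sound ⟨ObjectProperty.isoMk (P := fun A : Bilocale G H => A.str.IsPrincipal)
    (X := ⟨⟨Y, S⟩, hS⟩) (Y := ⟨⟨Z, T⟩, hT⟩) e⟩

lemma mk_eq_of_span (hS : S.IsPrincipal) (hT : T.IsPrincipal) (φ : Bilocale.Hom ⟨X, R⟩ ⟨Y, S⟩)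
    (hφ : IsOpenSurjection φ.f) (ψ : Bilocale.Hom ⟨X, R⟩ ⟨Z, T⟩)
    (h : ∀ {W : Locale.{u}} (a b : W ⟶ X), a ≫ φ.f = b ≫ φ.f → a ≫ ψ.f = b ≫ ψ.f) :
    mk S hS = mk T hT := by
  obtain ⟨χ, -⟩ := φ.exists_comp_eq hφ ψ h
  exact mk_eq_of_hom hS hT χ

end HSMap

/-! ### The bilocale structure of the tensor product -/

namespace BilocaleStr

variable {G H K : OpenGroupoid.{u}} {X X' Z : Locale.{u}} {S : BilocaleStr G H X}
  {S' : BilocaleStr H K X'} {T T' : BilocaleStr G K (tensor S S')}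

lemma prod_smul (g : Z ⟶ G.G₁) (c : Z ⟶ pullback S.q S'.p) (w : g ≫ G.r = c ≫ (prod S S').p) :
    (prod S S').smul g c w = pullback.lift
      (S.smul g (c ≫ pullback.fst _ _) (w.trans (Category.assoc _ _ _).symm))
      (c ≫ pullback.snd _ _) (by simp [pullback.condition]) := by
  have w' : g ≫ G.r = c ≫ pullback.fst S.q S'.p ≫ S.p := w
  change pullback.lift g c w' ≫ pullback.lift _ _ _ = _
  simp [comp_pullback_lift, LeftAction.comp_smul]

lemma prod_rmul (c : Z ⟶ pullback S.q S'.p) (k : Z ⟶ K.G₁) (w : c ≫ (prod S S').q = k ≫ K.d) :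
    (prod S S').rmul c k w = pullback.lift (c ≫ pullback.fst _ _)
      (S'.rmul (c ≫ pullback.snd _ _) k ((Category.assoc _ _ _).trans w))
      (by simp [pullback.condition]) := by
  have w' : c ≫ pullback.snd S.q S'.p ≫ S'.q = k ≫ K.d := w
  change pullback.lift c k w' ≫ pullback.lift _ _ _ = _
  simp [comp_pullback_lift, RightAction.comp_rmul]

lemma isInduced_of_hom (φ : Bilocale.Hom ⟨_, prod S S'⟩ ⟨_, T⟩) (h : φ.f = tensorProj S S') :
    S.IsInduced S' T where
  proj_p := h ▸ φ.f_p
  proj_q := h ▸ φ.f_q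
  act_proj g x x' w₁ w₂ := by
    have := φ.smul_f g (pullback.lift x x' w₂) (by simp [prod, w₁])
    simp only [prod_smul, h, pullback.lift_fst, pullback.lift_snd] at this
    exact this.symm
  ract_proj x x' k w₁ w₂ := by
    have := φ.rmul_f (pullback.lift x x' w₁) k (by simp [prod, w₂])
    simp only [prod_rmul, h, pullback.lift_fst, pullback.lift_snd] at this
    exact this.symm

lemma exists_of_comp_tensorProj_eq (hS' : S'.IsPrincipalBundle S'.q)
    {a b : Z ⟶ pullback S.q S'.p} (h : a ≫ tensorProj S S' = b ≫ tensorProj S S') :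
    ∃ (k : Z ⟶ H.G₁) (w₁ : (b ≫ pullback.fst _ _) ≫ S.q = k ≫ H.d)
      (w₂ : k ≫ H.r = (a ≫ pullback.snd _ _) ≫ S'.p),
      a ≫ pullback.fst _ _ = S.rmul (b ≫ pullback.fst _ _) k w₁ ∧
        S'.smul k (a ≫ pullback.snd _ _) w₂ = b ≫ pullback.snd _ _ :=
  exists_of_tens_eq hS' (by rwa [← comp_tensorProj, ← comp_tensorProj])

lemma exists_isInduced (hS' : S'.IsPrincipalBundle S'.q) :
    ∃ T : BilocaleStr G K (tensor S S'), S.IsInduced S' T := by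
  suffices ∃ (T : BilocaleStr G K (tensor S S')) (φ : Bilocale.Hom ⟨_, prod S S'⟩ ⟨_, T⟩),
      φ.f = tensorProj S S' by
    obtain ⟨T, φ, hφ⟩ := this
    exact ⟨T, isInduced_of_hom φ hφ⟩
  refine Bilocale.Hom.exists_descent (isOpenSurjection_tensorProj hS') (fun x y h => ?_)
    (fun g x y w w' h => ?_) (fun x y h => ?_) (fun x y k w w' h => ?_)
  all_goals obtain ⟨l, w₁, w₂, h_fst, h_snd⟩ := exists_of_comp_tensorProj_eq hS' h
  · rw [prod, ← Category.assoc, h_fst, rmul_p, Category.assoc]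
  · have wy : g ≫ G.r = (y ≫ pullback.fst _ _) ≫ S.p := w'.trans (Category.assoc _ _ _).symm
    have := rmul_tens (S.smul g (y ≫ pullback.fst _ _) wy) l _ ((smul_q _ _ _).trans w₁) w₂
    simp only [smul_rmul _ _ l wy w₁, ← h_fst, h_snd] at this
    simpa only [prod_smul, tens] using this
  · rw [prod, ← Category.assoc, ← Category.assoc, ← h_snd, smul_q]
  · have wx : (x ≫ pullback.snd _ _) ≫ S'.q = k ≫ K.d := (Category.assoc _ _ _).trans w
    have := rmul_tens _ l (S'.rmul (x ≫ pullback.snd _ _) k wx) w₁ (w₂.trans (rmul_p _ _ _).symm)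
    simp only [← smul_rmul l _ k w₂ wx, ← h_fst, h_snd] at this
    simpa only [prod_rmul, tens] using this

namespace IsInduced

/-- The quotient map `X ×_{H₀} X' ⟶ X ⊗_H X'` as a map of bilocales. -/
noncomputable def projHom (hT : S.IsInduced S' T) : Bilocale.Hom ⟨_, prod S S'⟩ ⟨_, T⟩ where
  f := tensorProj S S'
  f_p := hT.proj_p
  f_q := hT.proj_q
  act_f := by
    simp only [comp_tensorProj (pullback.snd G.r (prod S S').p)]
    exact (hT.act_proj _ _ _ _ _).symm
  ract_f := by
    simp only [comp_tensorProj (pullback.fst (prod S S').q K.d)]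
    exact (hT.ract_proj _ _ _ _ _).symm

lemma unique (hS' : S'.IsPrincipalBundle S'.q) (hT : S.IsInduced S' T) (hT' : S.IsInduced S' T') :
    T = T' := by
  have hproj := isOpenSurjection_tensorProj (S := S) hS'
  obtain ⟨χ, hχ⟩ := hT.projHom.exists_comp_eq hproj hT'.projHom fun _ _ h => h
  have := hproj.epi
  refine χ.str_eq_of_f_eq_id ?_
  rw [← cancel_epi (tensorProj S S'), Category.comp_id]
  exact hχ

lemma free (hT : S.IsInduced S' T) (hS : S.IsPrincipal) (hS' : S'.IsPrincipal)
    {g g' : Z ⟶ G.G₁} {t : Z ⟶ tensor S S'} {w : g ≫ G.r = t ≫ T.p} {w' : g' ≫ G.r = t ≫ T.p}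
    (h : T.smul g t w = T.smul g' t w') : g = g' := by
  obtain ⟨Z', ζ, c, hζ, hc⟩ := (isOpenSurjection_tensorProj (S := S) hS').exists_local_lift t
  have := hζ.epi
  have hp : c ≫ (prod S S').p = (ζ ≫ t) ≫ T.p := by rw [hc, Category.assoc, hT.proj_p, prod]
  have w₁ : (ζ ≫ g) ≫ G.r = c ≫ (prod S S').p := by rw [hp, Category.assoc, w, Category.assoc]
  have w₂ : (ζ ≫ g') ≫ G.r = c ≫ (prod S S').p := by rw [hp, Category.assoc, w', Category.assoc]
  have smul_proj : (prod S S').smul (ζ ≫ g) c w₁ ≫ tensorProj S S' =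
      (prod S S').smul (ζ ≫ g') c w₂ ≫ tensorProj S S' := by
    have := ζ ≫= h
    simp only [LeftAction.comp_smul, hc] at this
    exact (hT.projHom.smul_f _ c w₁).trans (this.trans (hT.projHom.smul_f _ c w₂).symm)
  have smul_c := (isPullback_tensorProj hS').hom_ext (by simp [prod_smul]) smul_proj
  rw [← cancel_epi ζ]
  exact hS.free (by simpa [prod_smul] using smul_c =≫ pullback.fst _ _)

lemma exists_smul_tens_eq (hT : S.IsInduced S' T) (hS : S.IsPrincipal) (hS' : S'.IsPrincipal)
    (c b : Z ⟶ pullback S.q S'.p)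
    (h : (c ≫ tensorProj S S') ≫ T.q = (b ≫ tensorProj S S') ≫ T.q) :
    ∃ (g : Z ⟶ G.G₁) (w : g ≫ G.r = (b ≫ tensorProj S S') ≫ T.p),
      T.smul g (b ≫ tensorProj S S') w = c ≫ tensorProj S S' := by
  have hq : (b ≫ pullback.snd _ _) ≫ S'.q = (c ≫ tensorProj S S') ≫ tensorQ S S' := by
    simpa [hT.proj_q, tensorProj_tensorQ] using h.symm
  let a := (isPullback_tensorProj hS').lift _ _ hq
  have a_snd : a ≫ pullback.snd _ _ = b ≫ pullback.snd _ _ := IsPullback.lift_fst _ _ _ _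
  have a_proj : a ≫ tensorProj S S' = c ≫ tensorProj S S' := IsPullback.lift_snd _ _ _ _
  obtain ⟨g, w, hg⟩ := hS.exists_smul_eq (a ≫ pullback.fst _ _) (b ≫ pullback.fst _ _)
    (by rw [Category.assoc, Category.assoc, pullback.condition, reassoc_of% a_snd])
  have w' : g ≫ G.r = b ≫ (prod S S').p := w.trans (Category.assoc _ _ _)
  have smul_b : (prod S S').smul g b w' = a := by
    rw [prod_smul]
    apply pullback.hom_ext <;> simp [hg, a_snd]
  refine ⟨g, by rw [w', Category.assoc, hT.proj_p, prod], ?_⟩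
  rw [← a_proj, ← smul_b]
  exact (hT.projHom.smul_f g b w').symm

theorem isPrincipal (hT : S.IsInduced S' T) (hS : S.IsPrincipal) (hS' : S'.IsPrincipal) :
    T.IsPrincipal := by
  have hproj := isOpenSurjection_tensorProj (S := S) hS'
  refine .of_free_of_local T.act_q (.of_comp (e := tensorProj S S') ?_ hproj.isSurjection)
    (fun _ _ _ _ _ h => hT.free hS hS' h) fun {Z} t s hts => ?_
  · rw [hT.proj_q]
    exact (hS.isOpenSurjection.pullback_snd _).comp hS'.isOpenSurjection
  · obtain ⟨Z₁, ζ₁, c, hζ₁, hc⟩ := hproj.exists_local_lift t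
    obtain ⟨Z₂, ζ₂, b, hζ₂, hb⟩ := hproj.exists_local_lift (ζ₁ ≫ s)
    have ht : (ζ₂ ≫ ζ₁) ≫ t = (ζ₂ ≫ c) ≫ tensorProj S S' := by
      rw [Category.assoc, hc, Category.assoc]
    have hs : (ζ₂ ≫ ζ₁) ≫ s = b ≫ tensorProj S S' := by rw [Category.assoc, hb]
    obtain ⟨g, w, hg⟩ := hT.exists_smul_tens_eq hS hS' (ζ₂ ≫ c) b (by
      rw [← ht, ← hs, Category.assoc, hts, ← Category.assoc])
    refine ⟨Z₂, ζ₂ ≫ ζ₁, g, by rw [w, hs], hζ₂.comp hζ₁, ?_⟩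
    simp only [hs, ht, hg]

end IsInduced

end BilocaleStr

/-! ### Functoriality, units and associativity of the tensor product -/

namespace Bilocale

variable {G H K : OpenGroupoid.{u}} {X X' Y Y' : Locale.{u}} {A B : Bilocale G H}
  {S : BilocaleStr G H X} {S' : BilocaleStr H K X'} {T : BilocaleStr G H Y}
  {T' : BilocaleStr H K Y'}

/-- A map of bilocales from a map of locales that is equivariant on generalized elements. -/
def Hom.ofEquivariant (f : A.X ⟶ B.X) (f_p : f ≫ B.str.p = A.str.p) (f_q : f ≫ B.str.q = A.str.q)
    (smul_f : ∀ {Z : Locale.{u}} (g : Z ⟶ G.G₁) (x : Z ⟶ A.X) (w : g ≫ G.r = x ≫ A.str.p),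
      A.str.smul g x w ≫ f = B.str.smul g (x ≫ f) (by rw [Category.assoc, f_p, w]))
    (rmul_f : ∀ {Z : Locale.{u}} (x : Z ⟶ A.X) (h : Z ⟶ H.G₁) (w : x ≫ A.str.q = h ≫ H.d),
      A.str.rmul x h w ≫ f = B.str.rmul (x ≫ f) h (by rw [Category.assoc, f_q, w])) :
    Hom A B where
  f := f
  f_p := f_p
  f_q := f_q
  act_f := by
    simpa [LeftAction.smul] using
      smul_f (pullback.fst G.r A.str.p) (pullback.snd _ _) pullback.condition
  ract_f := by
    simpa [RightAction.rmul] using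
      rmul_f (pullback.fst A.str.q H.d) (pullback.snd _ _) pullback.condition

/-- The map of bilocales `(x, x') ↦ (φ x, φ' x')`. -/
noncomputable def Hom.prodMap (φ : Hom ⟨X, S⟩ ⟨Y, T⟩) (φ' : Hom ⟨X', S'⟩ ⟨Y', T'⟩) :
    Hom ⟨_, S.prod S'⟩ ⟨_, T.prod T'⟩ :=
  .ofEquivariant
    (pullback.lift (pullback.fst _ _ ≫ φ.f) (pullback.snd _ _ ≫ φ'.f)
      (by simp only [Category.assoc, φ.f_q, φ'.f_p, pullback.condition]))
    (by simp [BilocaleStr.prod, φ.f_p]) (by simp [BilocaleStr.prod, φ'.f_q])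
    (fun g c w => by
      simp [BilocaleStr.prod_smul, comp_pullback_lift, φ.smul_f])
    (fun c k w => by
      simp [BilocaleStr.prod_rmul, comp_pullback_lift, φ'.rmul_f])

lemma Hom.isOpenSurjection_prodMap_id (φ : Hom ⟨X, S⟩ ⟨Y, T⟩) (hφ : IsOpenSurjection φ.f) :
    IsOpenSurjection (φ.prodMap (𝟙 (⟨X', S'⟩ : Bilocale H K))).f := by
  have h : (φ.prodMap (𝟙 (⟨X', S'⟩ : Bilocale H K))).f = pullbackMapFst S'.p φ.f φ.f_q := by
    apply pullback.hom_ext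
    · exact (pullback.lift_fst _ _ _).trans (pullbackMapFst_fst _ _ _).symm
    · exact (pullback.lift_snd _ _ _).trans
        ((Category.comp_id _).trans (pullbackMapFst_snd _ _ _).symm)
  exact h ▸ hφ.pullbackMapFst S'.p φ.f_q

end Bilocale

namespace BilocaleStr

variable {G H K L : OpenGroupoid.{u}} {X X' X'' : Locale.{u}} (S : BilocaleStr G H X)
  (S' : BilocaleStr H K X') (S'' : BilocaleStr K L X'')

/-- The right action as a map of bilocales. -/
noncomputable def ractHom : Bilocale.Hom ⟨_, S.prod (unit H)⟩ ⟨X, S⟩ :=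
  .ofEquivariant S.ract S.ract_p S.ract_q
    (fun g (c : _ ⟶ pullback S.q H.d) w => by
      have := S.smul_rmul g (c ≫ pullback.fst _ _) (c ≫ pullback.snd _ _)
        (w.trans (Category.assoc _ _ _).symm) (by simp [pullback.condition])
      simp only [← RightAction.comp_ract] at this
      exact (prod_smul (S' := unit H) g c w =≫ S.ract).trans this)
    (fun (c : _ ⟶ pullback S.q H.d) k w => by
      have := S.rmul_rmul (c ≫ pullback.fst _ _) (c ≫ pullback.snd _ _) k
        (by simp [pullback.condition]) ((Category.assoc _ _ _).trans w)
      simp only [← RightAction.comp_ract] at this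
      exact (prod_rmul (S' := unit H) c k w =≫ S.ract).trans this.symm)

/-- The left action as a map of bilocales. -/
noncomputable def actHom : Bilocale.Hom ⟨_, (unit G).prod S⟩ ⟨X, S⟩ :=
  .ofEquivariant S.act S.act_p S.act_q
    (fun g (c : _ ⟶ pullback G.r S.p) w => by
      have := S.mul_smul g (c ≫ pullback.fst _ _) (c ≫ pullback.snd _ _)
        (w.trans (Category.assoc _ _ _).symm) (by simp [pullback.condition])
      simp only [← LeftAction.comp_act] at this
      exact (prod_smul (S := unit G) g c w =≫ S.act).trans this)
    (fun (c : _ ⟶ pullback G.r S.p) k w => by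
      have := S.smul_rmul (c ≫ pullback.fst _ _) (c ≫ pullback.snd _ _) k
        (by simp [pullback.condition]) ((Category.assoc _ _ _).trans w)
      simp only [← LeftAction.comp_act] at this
      exact (prod_rmul (S := unit G) c k w =≫ S.act).trans this.symm)

/-- The map of bilocales `((x, x'), x'') ↦ (x, (x', x''))`. -/
noncomputable def prodAssocHom :
    Bilocale.Hom ⟨_, (S.prod S').prod S''⟩ ⟨_, S.prod (S'.prod S'')⟩ :=
  .ofEquivariant
    (pullback.lift (pullback.fst _ _ ≫ pullback.fst _ _)
      (pullback.lift (pullback.fst _ _ ≫ pullback.snd _ _) (pullback.snd _ _)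
        (by rw [Category.assoc]; exact pullback.condition))
      (by simp [prod, pullback.condition]))
    ((pullback.lift_fst_assoc _ _ _ _).trans (Category.assoc _ _ _))
    ((pullback.lift_snd_assoc _ _ _ _).trans (pullback.lift_snd_assoc _ _ _ _))
    (fun g c w => by
      simp [prod_smul, comp_pullback_lift])
    (fun c k w => by
      simp [prod_rmul, comp_pullback_lift])

end BilocaleStr

/-! ### The Hilsum–Skandalis maps of tensor products -/

namespace OpenGroupoid

variable {G : OpenGroupoid.{u}} {Z : Locale.{u}}

lemma mul_mul_inv (g h : Z ⟶ G.G₁) (w : g ≫ G.r = h ≫ G.d) :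
    G.mul (G.mul g h w) (h ≫ G.i) (by simp [G.i_d]) = g := by
  rw [mul_mul _ _ _ w (by simp [G.i_d])]
  simp only [mul_inv_self, ← reassoc_of% w, mul_unit]

lemma mul_inv_mul (g h : Z ⟶ G.G₁) (w : g ≫ G.r = h ≫ G.r) :
    G.mul (G.mul g (h ≫ G.i) (by simp [G.i_d, w])) h (by simp [G.i_r]) = g := by
  rw [mul_mul _ _ _ (by simp [G.i_d, w]) (by simp [G.i_r])]
  simp only [inv_mul_self, ← reassoc_of% w, mul_unit]

lemma i_i : G.i ≫ G.i = 𝟙 G.G₁ := by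
  have h := mul_mul_inv (𝟙 G.G₁) G.i (by simp [G.i_d])
  have mul_i := mul_inv_self (𝟙 G.G₁)
  have unit_mul_i := unit_mul (G.i ≫ G.i)
  simp only [Category.id_comp, Category.assoc, reassoc_of% G.i_d, reassoc_of% G.i_r]
    at h mul_i unit_mul_i
  simpa only [mul_i, unit_mul_i] using h

lemma isOpenSurjection_r (G : OpenGroupoid.{u}) : IsOpenSurjection G.r := by
  have : IsIso G.i := ⟨G.i, i_i, i_i⟩
  rw [← G.i_d]
  exact (IsOpenSurjection.of_isIso G.i).comp ⟨G.isOpenMap_d, isSurjection_of_section G.u_d⟩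

end OpenGroupoid

theorem BilocaleStr.unit_isPrincipal (G : OpenGroupoid.{u}) : (unit G).IsPrincipal := by
  refine .of_free_of_local G.m_r G.isOpenSurjection_r ?_ ?_
  · intro Z g g' x w w' (h : G.mul g x w = G.mul g' x w')
    rw [← OpenGroupoid.mul_mul_inv g x w, ← OpenGroupoid.mul_mul_inv g' x w']
    simp only [h]
  · intro Z x y (h : x ≫ G.r = y ≫ G.r)
    refine ⟨Z, 𝟙 Z, G.mul x (y ≫ G.i) (by simpa [G.i_d] using h), ?_, .of_isIso _, ?_⟩
    · simp [G.i_r, unit]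
    · simp only [Category.id_comp]
      exact OpenGroupoid.mul_inv_mul x y h

namespace BilocaleStr.IsInduced

variable {G H K L : OpenGroupoid.{u}} {X X' X'' Y Y' Z : Locale.{u}} {S : BilocaleStr G H X}
  {S' : BilocaleStr H K X'} {S'' : BilocaleStr K L X''}

lemma tens_p {T : BilocaleStr G K (tensor S S')} (hT : S.IsInduced S' T) (x : Z ⟶ X) (x' : Z ⟶ X')
    (w : x ≫ S.q = x' ≫ S'.p) : tens S S' x x' w ≫ T.p = x ≫ S.p := by
  rw [tens, Category.assoc, hT.proj_p, pullback.lift_fst_assoc]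

lemma tens_q {T : BilocaleStr G K (tensor S S')} (hT : S.IsInduced S' T) (x : Z ⟶ X) (x' : Z ⟶ X')
    (w : x ≫ S.q = x' ≫ S'.p) : tens S S' x x' w ≫ T.q = x' ≫ S'.q := by
  rw [tens, Category.assoc, hT.proj_q, pullback.lift_snd_assoc]

lemma smul_tens {T : BilocaleStr G K (tensor S S')} (hT : S.IsInduced S' T) (g : Z ⟶ G.G₁)
    (x : Z ⟶ X) (x' : Z ⟶ X') (w₁ : g ≫ G.r = x ≫ S.p) (w₂ : x ≫ S.q = x' ≫ S'.p) :
    T.smul g (tens S S' x x' w₂) (by rw [hT.tens_p, w₁]) =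
      tens S S' (S.smul g x w₁) x' (by rw [smul_q, w₂]) :=
  hT.act_proj g x x' w₁ w₂

lemma tens_rmul {T : BilocaleStr G K (tensor S S')} (hT : S.IsInduced S' T) (x : Z ⟶ X)
    (x' : Z ⟶ X') (k : Z ⟶ K.G₁) (w₁ : x ≫ S.q = x' ≫ S'.p) (w₂ : x' ≫ S'.q = k ≫ K.d) :
    T.rmul (tens S S' x x' w₁) k (by rw [hT.tens_q, w₂]) =
      tens S S' x (S'.rmul x' k w₂) (by rw [rmul_p, w₁]) :=
  hT.ract_proj x x' k w₁ w₂

lemma mk_eq_of_balanced {T : BilocaleStr G K (tensor S S')} {R : BilocaleStr G K Y}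
    (hT : S.IsInduced S' T) (hTp : T.IsPrincipal) (hS' : S'.IsPrincipal) (hR : R.IsPrincipal)
    (ψ : Bilocale.Hom ⟨_, prod S S'⟩ ⟨Y, R⟩)
    (h : ∀ {Z : Locale.{u}} (x : Z ⟶ X) (h : Z ⟶ H.G₁) (x' : Z ⟶ X') (w₁ : x ≫ S.q = h ≫ H.d)
      (w₂ : h ≫ H.r = x' ≫ S'.p),
      pullback.lift (S.rmul x h w₁) x' (by simp [w₂]) ≫ ψ.f =
        pullback.lift x (S'.smul h x' w₂) (by simp [w₁]) ≫ ψ.f) :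
    HSMap.mk T hTp = HSMap.mk R hR := by
  refine HSMap.mk_eq_of_span hTp hR hT.projHom (isOpenSurjection_tensorProj hS') ψ
    fun {Z} a b hab => ?_
  obtain ⟨k, w₁, w₂, h_fst, h_snd⟩ := exists_of_comp_tensorProj_eq hS' hab
  have ha : a = pullback.lift (S.rmul (b ≫ pullback.fst _ _) k w₁) (a ≫ pullback.snd _ _)
      (by rw [← h_fst, Category.assoc, Category.assoc, pullback.condition]) := by
    apply pullback.hom_ext <;> simp [h_fst]
  have hb : b = pullback.lift (b ≫ pullback.fst _ _) (S'.smul k (a ≫ pullback.snd _ _) w₂)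
      (by rw [h_snd, Category.assoc, Category.assoc, pullback.condition]) := by
    apply pullback.hom_ext <;> simp [h_snd]
  exact (ha =≫ ψ.f).trans ((h _ _ _ w₁ w₂).trans (hb =≫ ψ.f).symm)

lemma mk_eq_of_homs {T : BilocaleStr G K (tensor S S')} {R : BilocaleStr G H Y}
    {R' : BilocaleStr H K Y'} {T' : BilocaleStr G K (tensor R R')} (hT : S.IsInduced S' T)
    (hTp : T.IsPrincipal) (hS' : S'.IsPrincipal) (hT' : R.IsInduced R' T') (hTp' : T'.IsPrincipal)
    (φ : Bilocale.Hom ⟨X, S⟩ ⟨Y, R⟩) (φ' : Bilocale.Hom ⟨X', S'⟩ ⟨Y', R'⟩) :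
    HSMap.mk T hTp = HSMap.mk T' hTp' := by
  let ψ : (⟨_, prod S S'⟩ : Bilocale G K) ⟶ ⟨_, T'⟩ := φ.prodMap φ' ≫ hT'.projHom
  refine hT.mk_eq_of_balanced hTp hS' hTp' ψ fun x h x' w₁ w₂ => ?_
  change _ ≫ pullback.lift _ _ _ ≫ tensorProj R R' = _ ≫ pullback.lift _ _ _ ≫ tensorProj R R'
  have := rmul_tens (S := R) (S' := R') (x ≫ φ.f) h (x' ≫ φ'.f)
    (by rw [Category.assoc, φ.f_q, w₁]) (by rw [Category.assoc, φ'.f_p, w₂])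
  simpa [comp_pullback_lift_assoc, φ.rmul_f, φ'.smul_f, tens] using this

lemma mk_tensor_unit {T : BilocaleStr G H (tensor S (unit H))} (hT : S.IsInduced (unit H) T)
    (hTp : T.IsPrincipal) (hS : S.IsPrincipal) :
    HSMap.mk T hTp = HSMap.mk S hS :=
  hT.mk_eq_of_balanced hTp (unit_isPrincipal H) hS S.ractHom S.rmul_rmul

lemma mk_unit_tensor {T : BilocaleStr G H (tensor (unit G) S)} (hT : (unit G).IsInduced S T)
    (hTp : T.IsPrincipal) (hS : S.IsPrincipal) : HSMap.mk T hTp = HSMap.mk S hS :=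
  hT.mk_eq_of_balanced hTp hS hS S.actHom S.mul_smul

lemma tens_tens_eq {T₁ : BilocaleStr G K (tensor S S')} {T₂ : BilocaleStr H L (tensor S' S'')}
    (hT₁ : S.IsInduced S' T₁) (hT₂ : S'.IsInduced S'' T₂) (hS' : S'.IsPrincipal)
    (hS'' : S''.IsPrincipal) {x y : Z ⟶ X} {x' y' : Z ⟶ X'} {x'' y'' : Z ⟶ X''}
    {v : x ≫ S.q = x' ≫ S'.p} {v' : x' ≫ S'.q = x'' ≫ S''.p}
    {w : y ≫ S.q = y' ≫ S'.p} {w' : y' ≫ S'.q = y'' ≫ S''.p}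
    (h : tens T₁ S'' (tens S S' x x' v) x'' (by simp [hT₁.tens_q, v']) =
      tens T₁ S'' (tens S S' y y' w) y'' (by simp [hT₁.tens_q, w'])) :
    tens S T₂ x (tens S' S'' x' x'' v') (by simp [hT₂.tens_p, v]) =
      tens S T₂ y (tens S' S'' y' y'' w') (by simp [hT₂.tens_p, w]) := by
  obtain ⟨k, w₁, w₂, h_fst, rfl⟩ := exists_of_tens_eq hS'' h
  have w₃ : y' ≫ S'.q = k ≫ K.d := by rwa [hT₁.tens_q] at w₁
  obtain ⟨l, w₄, w₅, rfl, h_snd⟩ := exists_of_tens_eq hS' (h_fst.trans (hT₁.tens_rmul y y' k w w₃))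
  have smul_eq : T₂.smul l (tens S' S'' x' x'' v') (by rw [hT₂.tens_p, w₅]) =
      tens S' S'' y' (S''.smul k x'' w₂) w' := by
    simp only [hT₂.smul_tens l x' x'' w₅ v', h_snd, rmul_tens y' k x'' w₃ w₂]
  rw [rmul_tens y l _ w₄ (by rw [w₅, hT₂.tens_p])]
  simp only [smul_eq]

theorem mk_assoc {T₁ : BilocaleStr G K (tensor S S')} {T₂ : BilocaleStr H L (tensor S' S'')}
    {T₃ : BilocaleStr G L (tensor T₁ S'')} {T₄ : BilocaleStr G L (tensor S T₂)}
    (hT₁ : S.IsInduced S' T₁) (hT₂ : S'.IsInduced S'' T₂) (hT₃ : T₁.IsInduced S'' T₃)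
    (hT₄ : S.IsInduced T₂ T₄) (hS' : S'.IsPrincipal) (hS'' : S''.IsPrincipal)
    (hTp₃ : T₃.IsPrincipal) (hTp₄ : T₄.IsPrincipal) : HSMap.mk T₃ hTp₃ = HSMap.mk T₄ hTp₄ := by
  let φ : (⟨_, (S.prod S').prod S''⟩ : Bilocale G L) ⟶ ⟨_, T₃⟩ :=
    hT₁.projHom.prodMap (𝟙 (⟨X'', S''⟩ : Bilocale K L)) ≫ hT₃.projHom
  let ψ : (⟨_, (S.prod S').prod S''⟩ : Bilocale G L) ⟶ ⟨_, T₄⟩ :=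
    prodAssocHom S S' S'' ≫ Bilocale.Hom.prodMap (𝟙 (⟨X, S⟩ : Bilocale G H)) hT₂.projHom ≫
      hT₄.projHom
  have hφ : IsOpenSurjection φ.f :=
    (hT₁.projHom.isOpenSurjection_prodMap_id (isOpenSurjection_tensorProj hS')).comp
      (isOpenSurjection_tensorProj hS'')
  have v {W : Locale.{u}} (a : W ⟶ pullback (S.prod S').q S''.p) :
      ((a ≫ pullback.fst _ _) ≫ pullback.fst S.q S'.p) ≫ S.q =
        ((a ≫ pullback.fst _ _) ≫ pullback.snd S.q S'.p) ≫ S'.p := by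
    simp [pullback.condition]
  have v' {W : Locale.{u}} (a : W ⟶ pullback (S.prod S').q S''.p) :
      ((a ≫ pullback.fst _ _) ≫ pullback.snd S.q S'.p) ≫ S'.q =
        (a ≫ pullback.snd _ _) ≫ S''.p := by
    simp only [Category.assoc]
    exact a ≫= pullback.condition
  have φ_f {W : Locale.{u}} (a : W ⟶ pullback (S.prod S').q S''.p) : a ≫ φ.f =
      tens T₁ S'' (tens S S' _ _ (v a)) (a ≫ pullback.snd _ _) (by rw [hT₁.tens_q, v']) := by
    change a ≫ pullback.lift (_ ≫ tensorProj S S') (_ ≫ 𝟙 X'') _ ≫ tensorProj T₁ S'' = _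
    simp only [Category.comp_id, comp_tensorProj, comp_tens, Category.assoc, pullback.lift_fst,
      pullback.lift_snd]
  have ψ_f {W : Locale.{u}} (a : W ⟶ pullback (S.prod S').q S''.p) : a ≫ ψ.f =
      tens S T₂ _ (tens S' S'' _ _ (v' a)) (by rw [hT₂.tens_p, v]) := by
    change a ≫ pullback.lift _ (pullback.lift _ _ _) _ ≫
      pullback.lift (_ ≫ 𝟙 X) (_ ≫ tensorProj S' S'') _ ≫ tensorProj S T₂ = _
    simp only [Category.comp_id, comp_tensorProj, comp_tens, Category.assoc, pullback.lift_fst,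
      pullback.lift_snd, pullback.lift_snd_assoc]
  refine HSMap.mk_eq_of_span hTp₃ hTp₄ φ hφ ψ fun a b hab => ?_
  rw [φ_f, φ_f] at hab
  rw [ψ_f, ψ_f]
  exact tens_tens_eq hT₁ hT₂ hS' hS'' hab

end BilocaleStr.IsInduced

/-! ### The category of Hilsum–Skandalis maps -/

namespace BilocaleStr

variable {G H K : OpenGroupoid.{u}} {X X' : Locale.{u}} {S' : BilocaleStr H K X'}

/-- The induced bilocale structure on the tensor product with a principal bibundle. -/
noncomputable def tensorStr (S : BilocaleStr G H X) (hS' : S'.IsPrincipal) :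
    BilocaleStr G K (tensor S S') :=
  (exists_isInduced hS').choose

lemma isInduced_tensorStr (S : BilocaleStr G H X) (hS' : S'.IsPrincipal) :
    S.IsInduced S' (tensorStr S hS') :=
  (exists_isInduced hS').choose_spec

end BilocaleStr

namespace HSMap

open BilocaleStr

/-- The composite `[X ⊗_H X'] : K ⟶ G` of the Hilsum–Skandalis maps `[X'] : K ⟶ H` and
`[X] : H ⟶ G`. -/
noncomputable def comp {K H G : OpenGroupoid.{u}} (a : HSMap K H) (b : HSMap H G) : HSMap K G :=
  Quotient.liftOn₂ a b
    (fun A' A => mk (tensorStr A.obj.str A'.property)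
      ((isInduced_tensorStr _ A'.property).isPrincipal A.property A'.property))
    (by
      rintro A' A B' B ⟨e'⟩ ⟨e⟩
      exact (isInduced_tensorStr _ A'.property).mk_eq_of_homs _ A'.property
        (isInduced_tensorStr _ B'.property) _ e.hom.hom e'.hom.hom)

lemma comp_mk_mk {G H K : OpenGroupoid.{u}} {X X' : Locale.{u}} {S : BilocaleStr G H X}
    {S' : BilocaleStr H K X'} (hS : S.IsPrincipal) (hS' : S'.IsPrincipal)
    {T : BilocaleStr G K (S.tensor S')} (hT : T.IsPrincipal) (h : S.IsInduced S' T) :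
    comp (mk S' hS') (mk S hS) = mk T hT := by
  obtain rfl := IsInduced.unique hS' (isInduced_tensorStr S hS') h
  rfl

lemma exists_eq_mk {G H : OpenGroupoid.{u}} (a : HSMap H G) :
    ∃ (X : Locale.{u}) (S : BilocaleStr G H X) (hS : S.IsPrincipal), a = mk S hS := by
  obtain ⟨⟨⟨X, S⟩, hS⟩, rfl⟩ := Quotient.exists_rep a
  exact ⟨X, S, hS, rfl⟩

/-- The category of open groupoids and Hilsum–Skandalis maps. -/
@[reducible]
noncomputable def category : Category.{u + 1} OpenGroupoid.{u} where
  Hom := HSMap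
  id G := mk (unit G) (unit_isPrincipal G)
  comp := comp
  id_comp a := by
    obtain ⟨X, S, hS, rfl⟩ := exists_eq_mk a
    have h := isInduced_tensorStr S (unit_isPrincipal _)
    have hp := h.isPrincipal hS (unit_isPrincipal _)
    exact (comp_mk_mk hS (unit_isPrincipal _) hp h).trans (h.mk_tensor_unit hp hS)
  comp_id a := by
    obtain ⟨X, S, hS, rfl⟩ := exists_eq_mk a
    have h := isInduced_tensorStr (unit _) hS
    have hp := h.isPrincipal (unit_isPrincipal _) hS
    exact (comp_mk_mk (unit_isPrincipal _) hS hp h).trans (h.mk_unit_tensor hp hS)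
  assoc a b c := by
    obtain ⟨X'', S'', hS'', rfl⟩ := exists_eq_mk a
    obtain ⟨X', S', hS', rfl⟩ := exists_eq_mk b
    obtain ⟨X, S, hS, rfl⟩ := exists_eq_mk c
    have h₁ := isInduced_tensorStr S hS'
    have h₂ := isInduced_tensorStr S' hS''
    have p₁ := h₁.isPrincipal hS hS'
    have p₂ := h₂.isPrincipal hS' hS''
    have h₃ := isInduced_tensorStr (tensorStr S hS') hS''
    have h₄ := isInduced_tensorStr S p₂
    have p₃ := h₃.isPrincipal p₁ hS''
    have p₄ := h₄.isPrincipal hS p₂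
    change comp (comp _ _) _ = comp _ (comp _ _)
    rw [comp_mk_mk hS' hS'' p₂ h₂, comp_mk_mk hS hS' p₁ h₁, comp_mk_mk hS p₂ p₄ h₄,
      comp_mk_mk p₁ hS'' p₃ h₃]
    exact (h₁.mk_assoc h₂ h₃ h₄ hS' hS'' p₃ p₄).symm

end HSMap

theorem mainTheorem5 :
    (∀ (G H K : OpenGroupoid.{u}) (X X' : Locale.{u})
      (S : BilocaleStr G H X) (S' : BilocaleStr H K X'), S.IsPrincipal → S'.IsPrincipal →
        (∃! T : BilocaleStr G K (S.tensor S'), S.IsInduced S' T) ∧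
        ∀ T : BilocaleStr G K (S.tensor S'), S.IsInduced S' T → T.IsPrincipal) ∧
    ∃ (unit_principal : ∀ G : OpenGroupoid.{u}, (BilocaleStr.unit G).IsPrincipal)
      (comp : ∀ {K H G : OpenGroupoid.{u}}, HSMap K H → HSMap H G → HSMap K G),
      (∀ (G H K : OpenGroupoid.{u}) (X X' : Locale.{u})
        (S : BilocaleStr G H X) (S' : BilocaleStr H K X') (hS : S.IsPrincipal)
        (hS' : S'.IsPrincipal) (T : BilocaleStr G K (S.tensor S')) (hT : T.IsPrincipal),
        S.IsInduced S' T → comp (HSMap.mk S' hS') (HSMap.mk S hS) = HSMap.mk T hT) ∧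
      ∃ C : CategoryTheory.Category.{u + 1} OpenGroupoid.{u},
        C.toCategoryStruct =
          { Hom := HSMap
            id := fun G => HSMap.mk (BilocaleStr.unit G) (unit_principal G)
            comp := comp } := by
  refine ⟨fun G H K X X' S S' hS hS' => ⟨?_, fun T hT => hT.isPrincipal hS hS'⟩,
    BilocaleStr.unit_isPrincipal, HSMap.comp,
    fun G H K X X' S S' hS hS' T hT h => HSMap.comp_mk_mk hS hS' hT h, HSMap.category, rfl⟩
  obtain ⟨T, hT⟩ := BilocaleStr.exists_isInduced (S := S) hS'
  exact ⟨T, hT, fun T' hT' => BilocaleStr.IsInduced.unique hS' hT' hT⟩
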